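/- **Traversals are sound for leftmost linear reduction.** *Terms and reduction.* Let $M,N$ be untyped $\lambda$-terms (up to renaming of bound variables). The head lambda list is $\lambda_l(v)=\epsilon$ for a variable $v$, $\lambda_l(\lambda x.U)=\lambda x\cdot\lambda_l(U)$, and $\lambda_l(UV)$ is $\lambda_l(U)$ without its first element ($\epsilon$ if $\lambda_l(U)=\epsilon$). A generalized redex of $M$ is a pair $(\lambda x,V)$ where $UV$ is a subterm occurrence of $M$ and $\lambda x$ is the first element of $\lambda_l(U)$; the variable occurrences bound by $\lambda x$ are involved in it. Define $lloc_M$ on subterm occurrences: $lloc_M(v)=v$ if $v$ is involved in a generalized redex of $M$, else $\bot$; $lloc_M(\lambda x.U)=lloc_M(U)$; $lloc_M(UV)=lloc_M(U)$ if this is not $\bot$, otherwise $lloc_M(V)$ if $\lambda_l(U)=\epsilon$, otherwise $\bot$. Write $M\to_{ll}N$ if $lloc_M(M)\neq\bot$ and $N$ is obtained from $M$ by replacing that single variable occurrence by the argument of the generalized redex it is involved in, avoiding capture. *Tree.* The computation tree of a term has at its root a node $\lambda\overline x$ (possibly with empty $\overline x$) with a unique child: for $\lambda\overline x.\,z\,s_1\cdots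 s_m$ the child is a variable node $z$ whose children $1,\dots,m$ are the trees of $s_1,\dots,s_m$; for $\lambda\overline x.(\lambda y.t)s_1\cdots s_m$ with $m\ge1$ it is a node $@$ whose child $0$ is the tree of $\lambda y.t$ and whose children $1,\dots,m$ are the trees of the $s_j$. The arity $|n|$ of a node is the number of its bound variables for a lambda node and $m$ for a variable or $@$ node. Nodes enable other nodes, with link labels: a lambda node enables with label $k$ the variable nodes that carry its $k$-th bound variable; the root enables each free variable node, with a label that identifies the free variable; a variable or $@$ node enables its $k$-th child with label $k$. In addition each variable, $@$ or ghost variable node $m$ enables, for each $k>|m|$, a ghost lambda node with label $k$, and each (ghost) lambda node $\alpha$ enables, for each $k>|\alpha|$, a ghost variable node with label $k$; ghost nodes have arity $0$. A node is external if it is reachable from the root by the enabling relation, and internal otherwise. A justified sequence is a finite sequence of nodes in which an occurrence may carry a pointer, with a label, to an earlier occurrence that enables it with that label. Its P-view is read backwards: keep the last occurrence; after a variable or $@$ go on with the preceding occurrence, after a lambda with its justifier, and stop at a lambda without justifier. *Normalizing traversals* are the justified sequences generated by the following rules. (Root) The one-element sequence of the root. (App) $t\cdot @$ extends by the $0$-th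 child of $@$, pointing to $@$. (Lam) A traversal ending with a lambda node $\alpha$ of the tree extends by the child of $\alpha$: without pointer if it is $@$, and otherwise pointing to the occurrence of its enabler in the P-view. (Ghost Lam) A traversal ending with a ghost lambda that points with label $i$ to an occurrence $m$ (a variable, ghost variable or $@$) immediately preceded by $\alpha$ extends by the ghost variable pointing to $\alpha$ with label $|\alpha|+i-|m|$. (Var) A traversal ending with an internal (ghost) variable that points with label $i>0$ to an occurrence $\alpha$ immediately preceded by $m$ extends by the (possibly ghost) lambda node that $m$ enables with label $i$, pointing to that $m$. (IVar) A traversal $t$ ending with an external (ghost) variable $n$ extends, for each $1\le i\le\mathrm{ar}(t)$, by the (possibly ghost) lambda node that $n$ enables with label $i$, pointing to $n$. Here, if $\alpha_k\,n_k\cdots\alpha_1\,n_1$ ($n_1=n$) is the end of $t$ that starts with the last external lambda occurrence $\alpha_k$, then $$\mathrm{ar}(t)=\max_{1\le q\le k}\Big(|n_q|+\sum_{1\le j<q}(|n_j|-|\alpha_j|)\Big).$$ *Core.* The core $\pi(t)=\pi_\epsilon(t)$ is defined with a stack $\overline y$ of names by $\pi_{\overline y}(\epsilon)=\epsilon$ and: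 $\pi_{\overline y}(t\cdot n)$ is $\pi_\epsilon(t)\cdot n$ if $n$ is an external variable; $\pi_\epsilon(t)\cdot\lambda\overline x\,\overline y$ if $n$ is an external lambda binding $\overline x$ ($\overline x=\epsilon$ for a ghost); $\pi_{\overline x\,\overline y}(t)$ if $n$ is an internal lambda binding $\overline x$; and $\pi_{\overline y'}(t)$ if $n$ is an internal variable or an $@$, where $\overline y'$ is $\overline y$ without its first $|n|$ elements. Kept occurrences keep their justifiers and link labels. The *structure* of a justified sequence forgets the names: it records for each occurrence only its type (lambda, variable or $@$), the distance to its justifier and its link label. **Proposition.** If $M\to_{ll}N$, then the cores of the normalizing traversals of $M$ and of $N$ are isomorphic, that is: 1. the structures of the cores of the normalizing traversals of $M$ are exactly the structures of the cores of the normalizing traversals of $N$; 2. between the set of cores of those normalizing traversals of $M$ that end with an external occurrence and the corresponding set for $N$ there is a structure-preserving bijection. -/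

import Mathlib

/-! ### Untyped lambda terms and leftmost linear reduction -/

/-- Untyped lambda terms up to renaming of bound variables, in de Bruijn form: under `d` enclosing
abstractions, `var i` is bound by the `i`-th enclosing abstraction counted from the inside if
`i < d`, and is the free variable number `i - d` otherwise. -/
inductive Term where
  | var (i : ℕ)
  | lam (t : Term)
  | app (u v : Term)

/-- One step down in the syntax tree of a term. -/
inductive Dir where
  | body
  | fn
  | arg
  deriving DecidableEq

namespace Term

/-- The subterm occurrence at a position. -/
def subterm : Term → List Dir → Option Term
  | t, [] => some t
  | lam t, .body :: p => t.subterm p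
  | app u _, .fn :: p => u.subterm p
  | app _ v, .arg :: p => v.subterm p
  | _, _ => none

/-- Replace the subterm occurrence at a position. -/
def replaceAt : Term → List Dir → Term → Term
  | _, [], s => s
  | lam t, .body :: p, s => lam (t.replaceAt p s)
  | app u v, .fn :: p, s => app (u.replaceAt p s) v
  | app u v, .arg :: p, s => app u (v.replaceAt p s)
  | t, _, _ => t

/-- Add `d` to the indices of the variables not bound by the `c` innermost abstractions. -/
def shift (d : ℕ) : ℕ → Term → Term
  | c, var i => if i < c then var i else var (i + d)
  | c, lam t => lam (shift d (c + 1) t)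
  | c, app u v => app (shift d c u) (shift d c v)

/-- The head lambda list `λ_l` of a term, as the list of positions of its abstractions. -/
def headLams : Term → List (List Dir)
  | var _ => []
  | lam t => [] :: t.headLams.map (Dir.body :: ·)
  | app u _ => (u.headLams.map (Dir.fn :: ·)).tail

/-- The generalized redexes of a term: `GenRedex M q a` says that the abstraction at position `q`
and the subterm at position `a` form a generalized redex of `M`. -/
inductive GenRedex : Term → List Dir → List Dir → Prop
  | here {u v : Term} {q : List Dir} :
      u.headLams.head? = some q → GenRedex (app u v) (.fn :: q) [.arg]
  | lam {t : Term} {q a : List Dir} :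
      GenRedex t q a → GenRedex (lam t) (.body :: q) (.body :: a)
  | fn {u v : Term} {q a : List Dir} :
      GenRedex u q a → GenRedex (app u v) (.fn :: q) (.fn :: a)
  | arg {u v : Term} {q a : List Dir} :
      GenRedex v q a → GenRedex (app u v) (.arg :: q) (.arg :: a)

/-- The variable occurrence at position `p` is bound by the abstraction at position `q`. -/
def BoundBy (M : Term) (q p : List Dir) : Prop :=
  ∃ r : List Dir, p = q ++ Dir.body :: r ∧ M.subterm p = some (var (r.count Dir.body)) ∧
    ∃ t, M.subterm q = some (lam t)

/-- The variable occurrence at position `p` is involved in some generalized redex of `M`. -/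
def Involved (M : Term) (p : List Dir) : Prop :=
  ∃ q a, M.GenRedex q a ∧ M.BoundBy q p

open Classical in
/-- The function `lloc_M`: `lloc M t p` is its value at the subterm occurrence `t` that stands at
position `p` of `M`, and `none` is the undefined occurrence. -/
noncomputable def lloc (M : Term) : Term → List Dir → Option (List Dir)
  | var _, p => if M.Involved p then some p else none
  | lam t, p => lloc M t (p ++ [.body])
  | app u v, p =>
      match lloc M u (p ++ [.fn]) with
      | some q => some q
      | none => if u.headLams = [] then lloc M v (p ++ [.arg]) else none

/-- Leftmost linear reduction `M →ll N`: the leftmost linear variable occurrence, at position `p`,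
is involved in the generalized redex formed by the abstraction at `q` and the argument `A` at `a`,
and `N` is `M` with that single occurrence replaced by `A`, avoiding capture. The position `p` lies
under `p.count body - a.count body` more abstractions than `a`. -/
def LinStep (M N : Term) : Prop :=
  ∃ (p q a : List Dir) (A : Term), M.lloc M [] = some p ∧ M.GenRedex q a ∧ M.BoundBy q p ∧
    M.subterm a = some A ∧
    N = M.replaceAt p (shift (p.count Dir.body - a.count Dir.body) 0 A)

end Term

/-! ### Computation trees -/

/-- Computation trees. `node n h cs` is a bulk lambda node binding `n` variables (`n = 0` for a
dummy lambda) together with its unique child: a variable node with de Bruijn index `i` if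
`h = some i`, an `@`-node if `h = none`; `cs` lists the children (lambda nodes) of that node. -/
inductive CTree where
  | node (n : ℕ) (h : Option ℕ) (cs : List CTree)

/-- A bound name: the lambda node that binds it and its place `k ≥ 1` in the bulk. -/
abbrev BName := List ℕ × ℕ

namespace CTree

def lamArity : CTree → ℕ
  | node n _ _ => n

def head : CTree → Option ℕ
  | node _ h _ => h

/-- Number of operands of the variable or `@`-node (the operator of `@` is not counted). -/
def numOperands : CTree → ℕ
  | node _ (some _) cs => cs.length
  | node _ none cs => cs.length - 1

/-- The `k`-th child of the variable or `@`-node: operands are numbered from `1`, and the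
operator of an `@`-node is its child number `0`. -/
def child : CTree → ℕ → Option CTree
  | node _ (some _) _, 0 => none
  | node _ (some _) cs, k + 1 => cs[k]?
  | node _ none cs, k => cs[k]?

/-- The subtree rooted at the lambda node of given address (the list of child numbers chosen at
the successive variable or `@`-nodes on the path from the root). -/
def sub : CTree → List ℕ → Option CTree
  | T, [] => some T
  | T, k :: a => (T.child k).bind (fun c => c.sub a)

/-- The names bound by a bulk lambda node at address `a` with arity `n`. -/
def bulkNames (a : List ℕ) (n : ℕ) : List BName := (List.range n).map fun j => (a, j + 1)

def scopeFrom (pre : List ℕ) : CTree → List ℕ → List BName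
  | T, [] => bulkNames pre T.lamArity
  | T, k :: a => bulkNames pre T.lamArity ++
      match T.child k with
      | some c => scopeFrom (pre ++ [k]) c a
      | none => []

/-- The names in scope at the child of the lambda node at address `a`, outermost first. -/
def scope (T : CTree) (a : List ℕ) : List BName := T.scopeFrom [] a

end CTree

/-- The computation tree of a term. -/
def Term.ctree : Term → CTree
  | .var i => .node 0 (some i) []
  | .lam t =>
      match t.ctree with
      | .node n h cs => .node (n + 1) h cs
  | .app u v =>
      match u.ctree with
      | .node 0 h cs => .node 0 h (cs ++ [v.ctree])
      | .node (n + 1) h cs => .node 0 none [.node (n + 1) h cs, v.ctree]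

/-- Extended nodes: `lam a` is the lambda node at address `a`, `body a` is its unique child, and
ghost nodes are determined by their enabler and link label. -/
inductive TNode where
  | lam (a : List ℕ)
  | body (a : List ℕ)
  | ghostLam (m : TNode) (k : ℕ)
  | ghostVar (α : TNode) (k : ℕ)

/-- Link labels. The link from a free variable to the root is labelled by that variable. -/
inductive Link where
  | idx (k : ℕ)
  | free (x : ℕ)

/-- Node types. -/
inductive Kind where
  | lam
  | var
  | app

namespace CTree

def kind (T : CTree) : TNode → Kind
  | .lam _ => .lam
  | .ghostLam _ _ => .lam
  | .ghostVar _ _ => .var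
  | .body a => if (T.sub a).bind head = none then .app else .var

/-- Arity of an extended node; ghost nodes have arity `0`. -/
def arity (T : CTree) : TNode → ℕ
  | .lam a => ((T.sub a).map lamArity).getD 0
  | .body a => ((T.sub a).map numOperands).getD 0
  | _ => 0

/-- The names bound by a lambda node. -/
def names (T : CTree) : TNode → List BName
  | .lam a => bulkNames a (T.arity (.lam a))
  | _ => []

/-- The enabling relation on extended nodes: `Enables T m ℓ n` means that `m` enables `n` with
link label `ℓ`. -/
inductive Enables (T : CTree) : TNode → Link → TNode → Prop
  | child {a : List ℕ} {k : ℕ} {t c : CTree} :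
      T.sub a = some t → t.child k = some c → Enables T (.body a) (.idx k) (.lam (a ++ [k]))
  | bound {a b : List ℕ} {j k : ℕ} {t : CTree} :
      T.sub a = some t → t.head = some j → (T.scope a).reverse[j]? = some (b, k) →
      Enables T (.lam b) (.idx k) (.body a)
  | free {a : List ℕ} {x : ℕ} {t : CTree} :
      T.sub a = some t → t.head = some ((T.scope a).length + x) →
      Enables T (.lam []) (.free x) (.body a)
  | ghostLam {m : TNode} {k : ℕ} :
      T.kind m ≠ .lam → T.arity m < k → Enables T m (.idx k) (.ghostLam m k)
  | ghostVar {α : TNode} {k : ℕ} :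
      T.kind α = .lam → T.arity α < k → Enables T α (.idx k) (.ghostVar α k)

/-- External nodes: those hereditarily enabled by the root. -/
def External (T : CTree) (n : TNode) : Prop :=
  Relation.ReflTransGen (fun m n => ∃ ℓ, T.Enables m ℓ n) (.lam []) n

end CTree

/-! ### Justified sequences

Sequences are stored with their last occurrence first, so that `t · n` is `n :: t`. -/

/-- An occurrence: its node, its pending lambdas, the distance to its justifier (`0` if it has
none) and its link label (`idx 0` if it has no justifier). The justifier of the last occurrence of
`s` is the entry number `dist` of the list `s`. -/
structure Occ where
  node : TNode
  pending : List BName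
  dist : ℕ
  label : Link

/-- Justified sequences of nodes, last occurrence first. -/
abbrev JSeq := List Occ

namespace CTree

/-- `Visible T s d`: the occurrence standing `d` places before the last occurrence of `s` belongs
to the P-view of `s`. -/
inductive Visible (T : CTree) : JSeq → ℕ → Prop
  | last {o : Occ} {t : JSeq} : Visible T (o :: t) 0
  | nonlam {o : Occ} {t : JSeq} {k : ℕ} :
      T.kind o.node ≠ .lam → Visible T t k → Visible T (o :: t) (k + 1)
  | lam {o : Occ} {t : JSeq} {d k : ℕ} :
      T.kind o.node = .lam → o.dist = d + 1 → Visible T (t.drop d) k →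
      Visible T (o :: t) (k + (d + 1))

open Classical in
/-- The strand ending at the last occurrence, as the list of pairs
`(n₁, α₁), (n₂, α₂), …, (n_k, α_k)` read backwards, where `α_k` is the first external lambda node
met. -/
noncomputable def strand (T : CTree) : JSeq → List (TNode × TNode)
  | n :: α :: t =>
      (n.node, α.node) :: if T.External α.node then [] else T.strand t
  | _ => []

/-- `max_{1 ≤ q ≤ k} (|n_q| + ∑_{j < q} (|n_j| - |α_j|))`. -/
def strandThreshold (T : CTree) : List (TNode × TNode) → ℤ
  | [] => 0
  | [(n, _)] => T.arity n
  | (n, α) :: l => max (T.arity n : ℤ) ((T.arity n : ℤ) - T.arity α + T.strandThreshold l)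

/-- The arity threshold of a traversal ending with an external variable. -/
noncomputable def arth (T : CTree) (s : JSeq) : ℤ := T.strandThreshold (T.strand s)

/-- Normalizing traversals. -/
inductive NormTrav (T : CTree) : JSeq → Prop
  | root : NormTrav T [⟨.lam [], [], 0, .idx 0⟩]
  | app {o : Occ} {t : JSeq} {α : TNode} :
      NormTrav T (o :: t) → T.kind o.node = .app → T.Enables o.node (.idx 0) α →
      NormTrav T (⟨α, [], 1, .idx 0⟩ :: o :: t)
  | lamApp {o : Occ} {t : JSeq} {a : List ℕ} :
      NormTrav T (o :: t) → o.node = .lam a → T.kind (.body a) = .app →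
      NormTrav T (⟨.body a, [], 0, .idx 0⟩ :: o :: t)
  | lamVar {o β : Occ} {t : JSeq} {a : List ℕ} {d : ℕ} {ℓ : Link} :
      NormTrav T (o :: t) → o.node = .lam a → T.kind (.body a) = .var →
      (o :: t)[d]? = some β → T.Visible (o :: t) d → T.Enables β.node ℓ (.body a) →
      NormTrav T (⟨.body a, [], d + 1, ℓ⟩ :: o :: t)
  | lamGhost {o m α : Occ} {t : JSeq} {m₀ : TNode} {k₀ i : ℕ} :
      NormTrav T (o :: t) → o.node = .ghostLam m₀ k₀ → o.label = .idx i →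
      (o :: t)[o.dist]? = some m → (o :: t)[o.dist + 1]? = some α →
      NormTrav T (⟨.ghostVar α.node (T.arity α.node + i - T.arity m.node), [], o.dist + 2,
        .idx (T.arity α.node + i - T.arity m.node)⟩ :: o :: t)
  | var {o m α : Occ} {t : JSeq} {i : ℕ} {β : TNode} :
      NormTrav T (o :: t) → T.kind o.node = .var → ¬ T.External o.node →
      o.label = .idx i → 0 < i →
      (o :: t)[o.dist]? = some α → (o :: t)[o.dist + 1]? = some m →
      T.Enables m.node (.idx i) β →
      NormTrav T (⟨β, [], o.dist + 2, .idx i⟩ :: o :: t)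
  | ivar {o : Occ} {t : JSeq} {i : ℕ} {α : TNode} :
      NormTrav T (o :: t) → T.kind o.node = .var → T.External o.node →
      T.Enables o.node (.idx i) α → 1 ≤ i → (i : ℤ) ≤ T.arth (o :: t) →
      NormTrav T (⟨α, [], 1, .idx i⟩ :: o :: t)

open Classical in
/-- The core projection with stack of pending lambdas `y`. Internal occurrences are removed, and
distances are recomputed so that kept occurrences keep their justifiers. -/
noncomputable def coreAux (T : CTree) : List BName → JSeq → JSeq
  | _, [] => []
  | y, o :: t =>
      if T.External o.node then
        ⟨o.node, if T.kind o.node = .lam then o.pending ++ y else o.pending,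
          (t.take o.dist).countP (fun p => decide (T.External p.node)), o.label⟩ ::
          T.coreAux [] t
      else if T.kind o.node = .lam then T.coreAux (T.names o.node ++ o.pending ++ y) t
      else T.coreAux (y.drop (T.arity o.node)) t

/-- The core of a justified sequence. -/
noncomputable def core (T : CTree) (s : JSeq) : JSeq := T.coreAux [] s

/-- The structure (name-free representation) of a justified sequence: types, link distances and
link labels. -/
def shape (T : CTree) (s : JSeq) : List (Kind × ℕ × Link) :=
  s.map fun o => (T.kind o.node, o.dist, o.label)

/-- The cores of the normalizing traversals. -/
def cores (T : CTree) : Set JSeq := {c | ∃ s, T.NormTrav s ∧ T.core s = c}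

/-- The cores of the normalizing traversals whose last occurrence is external. -/
def extCores (T : CTree) : Set JSeq :=
  {c | ∃ o t, T.NormTrav (o :: t) ∧ T.External o.node ∧ T.core (o :: t) = c}

/-- Isomorphic sets of justified sequences, over two trees: there is a structure-preserving
bijection. -/
def Isomorphic (T₁ T₂ : CTree) (J₁ J₂ : Set JSeq) : Prop :=
  ∃ φ : J₁ → J₂, Function.Bijective φ ∧ ∀ j : J₁, T₂.shape (φ j).1 = T₁.shape j.1

end CTree

-- The structures of the cores, for `M` and for `N`, are identified with an invariant that mentions
-- neither trees nor traversals: the set `Term.paths` of paths of the Böhm tree. These paths arise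
-- by iterating head evaluation (`Term.Evals`), a variable being named by the place of the external
-- lambda that binds it together with its link label.
--
-- The invariant does not change under linear reduction. A linear step replaces a variable
-- occurrence by an argument that its binder will receive anyway. The relation `Inlines` records
-- this by carrying known values and pending arguments (`LinStep.inlines`). It is stable under
-- substitution (`Inlines.subst`), and since free variables have no known value, related terms make
-- the same head steps and reach the same head variable with related arguments (`Evals.inlines`,
-- `Evals.of_inlines`).
--
-- On the side of traversals, `CTree.sem` reads the end of a traversal as the state of an
-- environment machine. Moving from a lambda node of the tree to its child performs the head steps
-- of that piece of term (`NormTrav.evals_body`). Ghost moves and moves from internal variables and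
-- `@`-nodes leave the remaining evaluation unchanged (`NormTrav.evals_ghost`,
-- `NormTrav.evals_call`). The arity threshold is the number of pending arguments
-- (`NormTrav.arth_eq`). Hence the structure of a core is a path (`NormTrav.path`). Conversely, a
-- terminating head evaluation drives the traversal to an external variable
-- (`NormTrav.exists_external_var`), so every path is the structure of a core.
--
-- For the bijection, traversals are deterministic except for the label chosen by rule (IVar), and
-- this label survives in the core (`NormTrav.suffix_or_suffix`). A traversal that ends with an
-- external occurrence is therefore determined by the structure of its core
-- (`injOn_shape_extCores`), and equal sets of structures give a bijection of cores.

/-! ### Parallel substitution -/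

/-- The sequence `a, f 0, f 1, …`. -/
def scons {α : Type*} (a : α) (f : ℕ → α) : ℕ → α
  | 0 => a
  | i + 1 => f i

@[simp] theorem scons_zero {α : Type*} (a : α) (f : ℕ → α) : scons a f 0 = a := rfl
@[simp] theorem scons_succ {α : Type*} (a : α) (f : ℕ → α) (i : ℕ) : scons a f (i + 1) = f i := rfl

namespace Term

def rename : Term → (ℕ → ℕ) → Term
  | var i, ρ => var (ρ i)
  | lam t, ρ => lam (t.rename (scons 0 fun i => ρ i + 1))
  | app u v, ρ => app (u.rename ρ) (v.rename ρ)

/-- Weakening by one innermost variable. -/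
def weaken (t : Term) : Term := t.rename (· + 1)

/-- A substitution under one more abstraction. -/
def lift (σ : ℕ → Term) : ℕ → Term := scons (var 0) fun i => (σ i).weaken

/-- Capture-avoiding parallel substitution. -/
def subst : Term → (ℕ → Term) → Term
  | var i, σ => σ i
  | lam t, σ => lam (t.subst (lift σ))
  | app u v, σ => app (u.subst σ) (v.subst σ)

/-- Instantiation of the innermost variable. -/
def inst (t a : Term) : Term := t.subst (scons a var)

theorem rename_rename (t : Term) (ρ ρ' : ℕ → ℕ) :
    (t.rename ρ).rename ρ' = t.rename (fun i => ρ' (ρ i)) := by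
  induction t generalizing ρ ρ' with
  | var i => rfl
  | lam t ih =>
    simp only [rename, ih]
    congr 2; funext i; cases i <;> rfl
  | app u v hu hv => simp only [rename, hu, hv]

theorem rename_subst (t : Term) (ρ : ℕ → ℕ) (σ : ℕ → Term) :
    (t.rename ρ).subst σ = t.subst (fun i => σ (ρ i)) := by
  induction t generalizing ρ σ with
  | var i => rfl
  | lam t ih =>
    simp only [rename, subst, ih]
    congr 2; funext i; cases i <;> rfl
  | app u v hu hv => simp only [rename, subst, hu, hv]

theorem subst_rename (t : Term) (σ : ℕ → Term) (ρ : ℕ → ℕ) :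
    (t.subst σ).rename ρ = t.subst (fun i => (σ i).rename ρ) := by
  induction t generalizing ρ σ with
  | var i => rfl
  | lam t ih =>
    simp only [rename, subst, ih]
    congr 2; funext i
    cases i with
    | zero => rfl
    | succ i => simp [lift, weaken, rename_rename]
  | app u v hu hv => simp only [rename, subst, hu, hv]

theorem subst_subst (t : Term) (σ τ : ℕ → Term) :
    (t.subst σ).subst τ = t.subst (fun i => (σ i).subst τ) := by
  induction t generalizing σ τ with
  | var i => rfl
  | lam t ih =>
    simp only [subst, ih]
    congr 2; funext i
    cases i with
    | zero => rfl
    | succ i => simp [lift, weaken, rename_subst, subst_rename]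
  | app u v hu hv => simp only [subst, hu, hv]

theorem lift_var : lift var = var := by
  funext i; cases i <;> rfl

theorem subst_var (t : Term) : t.subst var = t := by
  induction t with
  | var i => rfl
  | lam t ih => simp only [subst, lift_var, ih]
  | app u v hu hv => simp only [subst, hu, hv]

theorem weaken_subst_lift (t : Term) (σ : ℕ → Term) :
    t.weaken.subst (lift σ) = (t.subst σ).weaken := by
  simp [weaken, rename_subst, subst_rename, lift]

theorem weaken_subst_scons (t a : Term) (σ : ℕ → Term) :
    t.weaken.subst (scons a σ) = t.subst σ := by
  simp [weaken, rename_subst]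

/-- This turns a β-step on a closure into an extension of its environment by the argument. -/
theorem subst_lift_inst (t a : Term) (σ : ℕ → Term) :
    (t.subst (lift σ)).inst a = t.subst (scons a σ) := by
  rw [inst, subst_subst]
  congr 1; funext i
  cases i with
  | zero => rfl
  | succ i => simp [lift, weaken_subst_scons, subst_var]

theorem weaken_rename (t : Term) (ρ : ℕ → ℕ) :
    t.weaken.rename (scons 0 fun i => ρ i + 1) = (t.rename ρ).weaken := by
  simp [weaken, rename_rename]

theorem shift_eq_rename (d c : ℕ) (t : Term) :
    shift d c t = t.rename (fun i => if i < c then i else i + d) := by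
  induction t generalizing c with
  | var i => simp only [shift, rename]; split_ifs <;> rfl
  | lam t ih =>
    simp only [shift, rename, ih]
    congr 2; funext i
    cases i with
    | zero => simp
    | succ i => simp only [scons_succ, Nat.add_lt_add_iff_right]; split_ifs <;> omega
  | app u v hu hv => simp only [shift, rename, hu, hv]

/-- Known values are weakened once at each abstraction crossed; this accumulates those weakenings
into the single shift of a linear step. -/
theorem shift_weaken (d : ℕ) (t : Term) : shift d 0 t.weaken = shift (d + 1) 0 t := by
  simp only [shift_eq_rename, weaken, rename_rename]
  congr 1; funext i; simp; omega

theorem shift_zero (c : ℕ) (t : Term) : shift 0 c t = t := by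
  induction t generalizing c with
  | var i => simp [shift]
  | lam t ih => simp only [shift, ih]
  | app u v hu hv => simp only [shift, hu, hv]

/-! ### Inlining known values -/

/-- Known values of the variables, in the scope of one more abstraction. -/
def extendKnown (a : Option Term) (Γ : ℕ → Option Term) : ℕ → Option Term :=
  scons a fun i => (Γ i).map weaken

/-- `Inlines Γ Δ t t'`: if `Γ` lists known values of variables and `Δ` known arguments of `t`, then
`t'` arises from `t` by replacing some variable occurrences by their known values. -/
inductive Inlines : (ℕ → Option Term) → List Term → Term → Term → Prop
  | var {Γ : ℕ → Option Term} {Δ : List Term} {i : ℕ} : Inlines Γ Δ (var i) (var i)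
  -- The inlined copy may itself be inlined further. Closure under related substitutions needs this,
  -- because the copy and its source receive different substitutes.
  | inline {Γ : ℕ → Option Term} {Δ : List Term} {i : ℕ} {a t' : Term} :
      Γ i = some a → Inlines Γ [] a t' → Inlines Γ Δ (var i) t'
  | lam_nil {Γ : ℕ → Option Term} {t t' : Term} :
      Inlines (extendKnown none Γ) [] t t' → Inlines Γ [] (lam t) (lam t')
  -- A pending argument meets its abstraction, so it becomes the known value of the bound variable.
  -- This is how generalized redexes are recognized.
  | lam_cons {Γ : ℕ → Option Term} {Δ : List Term} {a t t' : Term} :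
      Inlines (extendKnown (some a.weaken) Γ) (Δ.map weaken) t t' →
      Inlines Γ (a :: Δ) (lam t) (lam t')
  | app {Γ : ℕ → Option Term} {Δ : List Term} {u v u' v' : Term} :
      Inlines Γ (v :: Δ) u u' → Inlines Γ [] v v' → Inlines Γ Δ (app u v) (app u' v')

theorem Inlines.refl (Γ : ℕ → Option Term) (Δ : List Term) (t : Term) : Inlines Γ Δ t t := by
  induction t generalizing Γ Δ with
  | var i => exact .var
  | lam t ih =>
    cases Δ with
    | nil => exact .lam_nil (ih _ _)
    | cons a Δ => exact .lam_cons (ih _ _)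
  | app u v hu hv => exact .app (hu _ _) (hv _ _)

/-- More known values and more pending arguments only allow more inlining. In `Inlines.subst` a term
related without pending arguments replaces a variable that may have some. -/
theorem Inlines.mono {Γ Γ' : ℕ → Option Term} {Δ Δ' : List Term} {t t' : Term}
    (h : Inlines Γ Δ t t') (hΓ : ∀ i a, Γ i = some a → Γ' i = some a) (hΔ : Δ <+: Δ') :
    Inlines Γ' Δ' t t' := by
  induction h generalizing Γ' Δ' with
  | var => exact .var
  | inline hi _ ih => exact .inline (hΓ _ _ hi) (ih hΓ (List.prefix_refl _))
  | lam_nil _ ih =>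
    cases Δ' with
    | nil =>
      refine .lam_nil (ih ?_ (List.prefix_refl _))
      intro i a hi
      cases i with
      | zero => exact hi
      | succ i =>
        obtain ⟨b, hb, rfl⟩ := Option.map_eq_some_iff.1 hi
        simp [extendKnown, hΓ _ _ hb]
    | cons c Δ' =>
      refine .lam_cons (ih ?_ (List.nil_prefix))
      intro i a hi
      cases i with
      | zero => simp [extendKnown] at hi
      | succ i =>
        obtain ⟨b, hb, rfl⟩ := Option.map_eq_some_iff.1 hi
        simp [extendKnown, hΓ _ _ hb]
  | @lam_cons Γ Δ c t t' _ ih =>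
    obtain ⟨Δ₂, rfl⟩ := hΔ
    refine .lam_cons (ih ?_ ?_)
    · intro i a hi
      cases i with
      | zero => exact hi
      | succ i =>
        obtain ⟨b, hb, rfl⟩ := Option.map_eq_some_iff.1 hi
        simp [extendKnown, hΓ _ _ hb]
    · exact ⟨Δ₂.map weaken, by simp⟩
  | app _ _ hu hv =>
    exact .app (hu hΓ (by simpa using hΔ)) (hv hΓ (List.prefix_refl _))

theorem Inlines.rename {Γ Γ' : ℕ → Option Term} {Δ : List Term} {t t' : Term} {ρ : ℕ → ℕ}
    (h : Inlines Γ Δ t t') (hΓ : ∀ i a, Γ i = some a → Γ' (ρ i) = some (a.rename ρ)) :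
    Inlines Γ' (Δ.map (·.rename ρ)) (t.rename ρ) (t'.rename ρ) := by
  have key : ∀ {Γ Γ' : ℕ → Option Term} {ρ : ℕ → ℕ} {a : Option Term},
      (∀ i a, Γ i = some a → Γ' (ρ i) = some (a.rename ρ)) →
      ∀ i b, extendKnown a Γ i = some b →
        extendKnown (a.map (·.rename (scons 0 fun i => ρ i + 1))) Γ'
          (scons 0 (fun i => ρ i + 1) i) = some (b.rename (scons 0 fun i => ρ i + 1)) := by
    intro Γ Γ' ρ a hΓ i b hi
    cases i with
    | zero => simp only [extendKnown, scons_zero] at hi ⊢; simp [hi]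
    | succ i =>
      obtain ⟨b, hb, rfl⟩ := Option.map_eq_some_iff.1 hi
      simp [extendKnown, hΓ _ _ hb, weaken_rename]
  induction h generalizing Γ' ρ with
  | var => exact .var
  | inline hi _ ih => exact .inline (hΓ _ _ hi) (ih hΓ)
  | lam_nil _ ih => exact .lam_nil (ih (key hΓ))
  | lam_cons _ ih =>
    refine .lam_cons ?_
    have := ih (key hΓ)
    simpa [weaken_rename, Function.comp_def] using this
  | app _ _ hu hv => exact .app (hu hΓ) (hv hΓ)

/-- A variable with a known value is sent either to that value, so that the substitution itself
performs the inlining on the left, or to a variable that still has the substituted value as its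
known value, so that inlining remains possible. -/
theorem Inlines.subst {Γ Γ' : ℕ → Option Term} {Δ : List Term} {t t' : Term} {σ σ' : ℕ → Term}
    (h : Inlines Γ Δ t t') (hσ : ∀ i, Inlines Γ' [] (σ i) (σ' i))
    (hΓ : ∀ i a, Γ i = some a →
      σ i = a.subst σ ∨ ∃ j, σ i = Term.var j ∧ Γ' j = some (a.subst σ)) :
    Inlines Γ' (Δ.map (·.subst σ)) (t.subst σ) (t'.subst σ') := by
  have key : ∀ {Γ Γ' : ℕ → Option Term} {σ : ℕ → Term} {a : Option Term},
      (∀ i a, Γ i = some a →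
        σ i = a.subst σ ∨ ∃ j, σ i = Term.var j ∧ Γ' j = some (a.subst σ)) →
      ∀ i b, extendKnown a Γ i = some b →
        lift σ i = b.subst (lift σ) ∨ ∃ j, lift σ i = Term.var j ∧
          extendKnown (a.map (·.subst (lift σ))) Γ' j = some (b.subst (lift σ)) := by
    intro Γ Γ' σ a hΓ i b hi
    cases i with
    | zero =>
      right
      simp only [extendKnown, scons_zero] at hi
      exact ⟨0, rfl, by simp [extendKnown, hi]⟩
    | succ i =>
      obtain ⟨b, hb, rfl⟩ := Option.map_eq_some_iff.1 hi
      rcases hΓ _ _ hb with h | ⟨j, hj, h⟩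
      · left; rw [weaken_subst_lift, ← h]; rfl
      · right
        exact ⟨j + 1, by simp [lift, hj, weaken, Term.rename], by
          simp [extendKnown, h, weaken_subst_lift]⟩
  have keyσ : ∀ {Γ' : ℕ → Option Term} {σ σ' : ℕ → Term} {a : Option Term},
      (∀ i, Inlines Γ' [] (σ i) (σ' i)) →
      ∀ i, Inlines (extendKnown a Γ') [] (lift σ i) (lift σ' i) := by
    intro Γ' σ σ' a hσ i
    cases i with
    | zero => exact .var
    | succ i =>
      have := (hσ i).rename (ρ := (· + 1)) (Γ' := extendKnown a Γ')
        (by intro i a hi; simp [extendKnown, hi, weaken])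
      simpa [lift, weaken] using this
  induction h generalizing Γ' σ σ' with
  | var => exact (hσ _).mono (fun _ _ h => h) List.nil_prefix
  | inline hi _ ih =>
    rcases hΓ _ _ hi with h | ⟨j, hj, h⟩
    · simp only [Term.subst]
      rw [h]
      exact (ih hσ hΓ).mono (fun _ _ h => h) List.nil_prefix
    · simp only [Term.subst]
      rw [hj]
      exact .inline h (ih hσ hΓ)
  | lam_nil _ ih => exact .lam_nil (ih (keyσ hσ) (key hΓ))
  | lam_cons _ ih =>
    refine .lam_cons ?_
    have := ih (keyσ hσ) (key hΓ)
    simpa [weaken_subst_lift, Function.comp_def] using this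
  | app _ _ hu hv => exact .app (hu hσ hΓ) (hv hσ hΓ)

/-- No known values. -/
def unknown : ℕ → Option Term := fun _ => none

theorem extendKnown_none_unknown : extendKnown none unknown = unknown := by
  funext i; cases i <;> rfl

/-- A β-step on both sides: the known value of the bound variable is now actually substituted, and
no known value is left. -/
theorem Inlines.inst {Δ : List Term} {a a' t t' : Term}
    (h : Inlines (extendKnown (some a.weaken) unknown) (Δ.map weaken) t t')
    (ha : Inlines unknown [] a a') : Inlines unknown Δ (t.inst a) (t'.inst a') := by
  have := h.subst (Γ' := unknown) (σ := scons a Term.var) (σ' := scons a' Term.var)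
    (by intro i; cases i with
      | zero => exact ha
      | succ i => exact .var)
    (by intro i b hi; cases i with
      | zero =>
        left
        simp only [extendKnown, scons_zero, Option.some.injEq] at hi
        rw [← hi, weaken_subst_scons, subst_var]; rfl
      | succ i => simp [extendKnown, unknown] at hi)
  simpa [Function.comp_def, weaken_subst_scons, subst_var, Term.inst] using this

theorem Inlines.open_var {t t' : Term} (h : Inlines unknown [] t t') (x : ℕ) :
    Inlines unknown [] (t.inst (Term.var x)) (t'.inst (Term.var x)) :=
  h.subst (fun i => by cases i <;> exact .var) (fun _ _ hi => by simp [unknown] at hi)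

/-! ### Linear steps inline known values -/

/-- Crossing an abstraction raises the index of the variable and weakens its known value by one, so
at `r` the known value appears shifted by the number of abstractions crossed. -/
theorem inlines_replaceAt_var {Γ : ℕ → Option Term} {Δ : List Term} {t b : Term} {r : List Dir}
    {i : ℕ} (hr : t.subterm r = some (var (r.count Dir.body + i))) (hi : Γ i = some b) :
    Inlines Γ Δ t (t.replaceAt r (shift (r.count Dir.body) 0 b)) := by
  induction r generalizing Γ Δ t i b with
  | nil =>
    simp only [subterm, Option.some.injEq] at hr
    subst hr
    refine .inline (by simpa using hi) ?_
    simp only [replaceAt, List.count_nil, shift_zero]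
    exact .refl _ _ _
  | cons x r ih =>
    cases t with
    | var j => cases x <;> simp [subterm] at hr
    | lam t =>
      cases x <;> simp only [subterm, reduceCtorEq] at hr
      simp only [List.count_cons_self] at hr ⊢
      rw [← shift_weaken]
      have hr' : t.subterm r = some (var (r.count Dir.body + (i + 1))) := by
        rw [hr]; congr 2; omega
      cases Δ with
      | nil => exact .lam_nil (ih hr' (by simp [extendKnown, hi]))
      | cons a Δ => exact .lam_cons (ih hr' (by simp [extendKnown, hi]))
    | app u v =>
      cases x <;> simp only [subterm, reduceCtorEq] at hr
      · rw [List.count_cons_of_ne (by decide)] at hr ⊢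
        exact .app (ih hr hi) (.refl _ _ _)
      · rw [List.count_cons_of_ne (by decide)] at hr ⊢
        exact .app (.refl _ _ _) (ih hr hi)

/-- The `j`-th head abstraction consumes the `j`-th pending argument. Entering the function of an
application puts one argument in front and restores the head abstraction that it cancels, so both
indices move to `j + 1`. -/
theorem inlines_replaceAt_headLams {Γ : ℕ → Option Term} {Δ : List Term} {u b : Term}
    {q r : List Dir} {j : ℕ} (hq : u.headLams[j]? = some q) (hb : Δ[j]? = some b)
    (hr : u.subterm (q ++ Dir.body :: r) = some (var (r.count Dir.body))) :
    Inlines Γ Δ u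
      (u.replaceAt (q ++ Dir.body :: r) (shift ((q ++ Dir.body :: r).count Dir.body) 0 b)) := by
  induction u generalizing Γ Δ q j b with
  | var i => simp [headLams] at hq
  | lam t ih =>
    cases Δ with
    | nil => simp at hb
    | cons a Δ =>
      cases j with
      | zero =>
        simp only [headLams, List.getElem?_cons_zero, Option.some.injEq] at hq hb
        subst hq hb
        simp only [List.nil_append, subterm, List.count_cons_self] at hr ⊢
        rw [← shift_weaken]
        exact .lam_cons (inlines_replaceAt_var (i := 0) (by simpa using hr) (by simp [extendKnown]))
      | succ j =>
        simp only [headLams, List.getElem?_cons_succ, List.getElem?_map,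
          Option.map_eq_some_iff] at hq hb
        obtain ⟨q', hq', rfl⟩ := hq
        simp only [List.cons_append, subterm] at hr
        simp only [List.cons_append, List.count_cons_self]
        rw [← shift_weaken]
        exact .lam_cons (ih hq' (by simp [hb]) hr)
  | app u v ihu _ =>
    simp only [headLams, List.getElem?_tail, List.getElem?_map, Option.map_eq_some_iff] at hq
    obtain ⟨q', hq', rfl⟩ := hq
    simp only [List.cons_append, subterm] at hr
    simp only [List.cons_append]
    rw [List.count_cons_of_ne (by decide)]
    exact .app (ihu hq' (by simpa using hb) hr) (.refl _ _ _)

/-- Descend to the application that forms the redex, whose argument is then pending for the first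
head abstraction. Abstractions above that application count for both positions and cancel in the
shift. -/
theorem GenRedex.inlines {M A : Term} {q a r : List Dir} (h : M.GenRedex q a)
    (hr : M.subterm (q ++ Dir.body :: r) = some (var (r.count Dir.body)))
    (hA : M.subterm a = some A) (Γ : ℕ → Option Term) (Δ : List Term) :
    Inlines Γ Δ M (M.replaceAt (q ++ Dir.body :: r)
      (shift ((q ++ Dir.body :: r).count Dir.body - a.count Dir.body) 0 A)) := by
  induction h generalizing Γ Δ with
  | @here u v q hq =>
    simp only [subterm, Option.some.injEq] at hA
    subst hA
    simp only [List.cons_append, subterm] at hr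
    simp only [List.cons_append]
    rw [List.count_cons_of_ne (by decide)]
    refine .app ?_ (.refl _ _ _)
    exact inlines_replaceAt_headLams (j := 0) (by rwa [List.head?_eq_getElem?] at hq) (by simp) hr
  | lam _ ih =>
    simp only [List.cons_append, subterm] at hr hA
    simp only [List.cons_append, List.count_cons_self, Nat.add_sub_add_right]
    cases Δ with
    | nil => exact .lam_nil (ih hr hA _ _)
    | cons b Δ => exact .lam_cons (ih hr hA _ _)
  | fn _ ih =>
    simp only [List.cons_append, subterm] at hr hA
    simp only [List.cons_append]
    rw [List.count_cons_of_ne (by decide), List.count_cons_of_ne (by decide)]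
    exact .app (ih hr hA _ _) (.refl _ _ _)
  | arg _ ih =>
    simp only [List.cons_append, subterm] at hr hA
    simp only [List.cons_append]
    rw [List.count_cons_of_ne (by decide), List.count_cons_of_ne (by decide)]
    exact .app (.refl _ _ _) (ih hr hA _ _)

theorem LinStep.inlines {M N : Term} (h : M.LinStep N) : Inlines unknown [] M N := by
  obtain ⟨p, q, a, A, -, hg, ⟨r, rfl, hr, -⟩, hA, rfl⟩ := h
  exact hg.inlines hr hA _ _

/-! ### Head evaluation and the paths of the Böhm tree -/

/-- Free variables are names: the name of the variable that is bound with label `ℓ` at the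
external lambda at place `p`. -/
def name (p : ℕ) (ℓ : Link) : ℕ :=
  Nat.pair p (match ℓ with | .idx k => 2 * k | .free x => 2 * x + 1)

def namePos (x : ℕ) : ℕ := x.unpair.1

def nameLink (x : ℕ) : Link :=
  if x.unpair.2 % 2 = 0 then .idx (x.unpair.2 / 2) else .free (x.unpair.2 / 2)

@[simp] theorem namePos_name (p : ℕ) (ℓ : Link) : namePos (name p ℓ) = p := by
  simp [namePos, name]

@[simp] theorem nameLink_name (p : ℕ) (ℓ : Link) : nameLink (name p ℓ) = ℓ := by
  cases ℓ with
  | idx k => simp [nameLink, name]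
  | free x => simp [nameLink, name]; omega

/-- `Evals p k t π x as c`: the term `t` with arguments `π`, below `k` abstractions that already
belong to the lambda at place `p`, has after `c` steps of head reduction head variable `x` and
arguments `as`. -/
inductive Evals (p : ℕ) : ℕ → Term → List Term → ℕ → List Term → ℕ → Prop
  | var {k x : ℕ} {π : List Term} : Evals p k (var x) π x π 0
  | app {k x c : ℕ} {u v : Term} {π as : List Term} :
      Evals p k u (v :: π) x as c → Evals p k (app u v) π x as (c + 1)
  | beta {k x c : ℕ} {t a : Term} {π as : List Term} :
      Evals p k (t.inst a) π x as c → Evals p k (lam t) (a :: π) x as (c + 1)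
  | lam {k x c : ℕ} {t : Term} {as : List Term} :
      Evals p (k + 1) (t.inst (Term.var (name p (.idx (k + 1))))) [] x as c →
      Evals p k (lam t) [] x as (c + 1)

/-- Structures of justified sequences. -/
abbrev Shape := List (Kind × ℕ × Link)

/-- The structure of a variable occurrence with head variable `x`, added to a path. -/
def varStep (s : Shape) (x : ℕ) : Shape :=
  -- Places are counted from 1 and the new occurrence has place `s.length + 1`, so the difference is
  -- the distance to the binder.
  (.var, s.length + 1 - namePos x, nameLink x) :: s

/-- Paths of the Böhm tree that end with a lambda, and the subterm found there. -/
inductive LamPath (M : Term) : Shape → Term → Prop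
  | root : LamPath M [(.lam, 0, .idx 0)] (M.subst fun i => var (name 1 (.free i)))
  | arg {s : Shape} {t u : Term} {x c i : ℕ} {as : List Term} :
      LamPath M s t → Evals s.length 0 t [] x as c → as[i]? = some u →
      LamPath M ((.lam, 1, .idx (i + 1)) :: varStep s x) u

/-- Paths of the Böhm tree that end with a variable, and the arguments of that variable. -/
inductive VarPath (M : Term) : Shape → List Term → Prop
  | var {s : Shape} {t : Term} {x c : ℕ} {as : List Term} :
      LamPath M s t → Evals s.length 0 t [] x as c → VarPath M (varStep s x) as

/-- The paths of the Böhm tree. -/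
def paths (M : Term) : Set Shape := {s | (∃ t, LamPath M s t) ∨ ∃ as, VarPath M s as}

-- Invariance of head evaluation and of paths under inlining

/-- The two evaluations run in lockstep. A head variable is free, hence without known value, so it
cannot be inlined; every known value of a bound variable comes from a pending argument, which the
β-step substitutes. -/
theorem Evals.inlines {p k x c : ℕ} {t t' : Term} {π π' as : List Term}
    (h : Evals p k t π x as c) (ht : Inlines unknown π t t')
    (hπ : List.Forall₂ (Inlines unknown []) π π') :
    ∃ as', Evals p k t' π' x as' c ∧ List.Forall₂ (Inlines unknown []) as as' := by
  induction h generalizing t' π' with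
  | var =>
    cases ht with
    | var => exact ⟨_, .var, hπ⟩
    | inline h => simp [unknown] at h
  | app _ ih =>
    cases ht with
    | app hu hv =>
      obtain ⟨as', h, has⟩ := ih hu (.cons hv hπ)
      exact ⟨as', .app h, has⟩
  | beta _ ih =>
    cases ht with
    | lam_cons ht =>
      cases hπ with
      | cons ha hπ =>
        obtain ⟨as', h, has⟩ := ih (ht.inst ha) hπ
        exact ⟨as', .beta h, has⟩
  | lam _ ih =>
    cases hπ
    cases ht with
    | lam_nil ht =>
      rw [extendKnown_none_unknown] at ht
      obtain ⟨as', h, has⟩ := ih (ht.open_var _) .nil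
      exact ⟨as', .lam h, has⟩

theorem Evals.of_inlines {p k x c : ℕ} {t t' : Term} {π π' as' : List Term}
    (h : Evals p k t' π' x as' c) (ht : Inlines unknown π t t')
    (hπ : List.Forall₂ (Inlines unknown []) π π') :
    ∃ as, Evals p k t π x as c ∧ List.Forall₂ (Inlines unknown []) as as' := by
  induction h generalizing t π with
  | var =>
    cases ht with
    | var => exact ⟨_, .var, hπ⟩
    | inline h => simp [unknown] at h
  | app _ ih =>
    cases ht with
    | inline h => simp [unknown] at h
    | app hu hv =>
      obtain ⟨as', h, has⟩ := ih hu (.cons hv hπ)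
      exact ⟨as', .app h, has⟩
  | beta _ ih =>
    cases hπ with
    | cons ha hπ =>
      cases ht with
      | inline h => simp [unknown] at h
      | lam_cons ht =>
        obtain ⟨as', h, has⟩ := ih (ht.inst ha) hπ
        exact ⟨as', .beta h, has⟩
  | lam _ ih =>
    cases hπ
    cases ht with
    | inline h => simp [unknown] at h
    | lam_nil ht =>
      rw [extendKnown_none_unknown] at ht
      obtain ⟨as', h, has⟩ := ih (ht.open_var _) .nil
      exact ⟨as', .lam h, has⟩

theorem Inlines.closeRoot {M N : Term} (h : Inlines unknown [] M N) :
    Inlines unknown [] (M.subst fun i => Term.var (name 1 (.free i)))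
      (N.subst fun i => Term.var (name 1 (.free i))) :=
  h.subst (fun _ => .var) (fun _ _ hi => by simp [unknown] at hi)

theorem LamPath.inlines {M N : Term} (h : Inlines unknown [] M N) {s : Shape} {t : Term}
    (hs : LamPath M s t) : ∃ t', LamPath N s t' ∧ Inlines unknown [] t t' := by
  induction hs with
  | root => exact ⟨_, .root, h.closeRoot⟩
  | @arg s t u x c i as _ he hi ih =>
    obtain ⟨t', hl, ht⟩ := ih
    obtain ⟨as', he', has⟩ := he.inlines ht .nil
    obtain ⟨hi', rfl⟩ := List.getElem?_eq_some_iff.1 hi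
    have hi₂ := has.length_eq ▸ hi'
    exact ⟨as'[i], .arg hl he' (List.getElem?_eq_getElem hi₂), has.get hi' hi₂⟩

theorem LamPath.of_inlines {M N : Term} (h : Inlines unknown [] M N) {s : Shape} {t' : Term}
    (hs : LamPath N s t') : ∃ t, LamPath M s t ∧ Inlines unknown [] t t' := by
  induction hs with
  | root => exact ⟨_, .root, h.closeRoot⟩
  | @arg s t u x c i as' _ he hi ih =>
    obtain ⟨t', hl, ht⟩ := ih
    obtain ⟨as, he', has⟩ := he.of_inlines ht .nil
    obtain ⟨hi', rfl⟩ := List.getElem?_eq_some_iff.1 hi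
    have hi₂ := has.length_eq ▸ hi'
    exact ⟨as[i], .arg hl he' (List.getElem?_eq_getElem hi₂), has.get hi₂ hi'⟩

theorem paths_eq_of_inlines {M N : Term} (h : Inlines unknown [] M N) : paths M = paths N := by
  ext s
  constructor
  · rintro (⟨t, ht⟩ | ⟨as, ⟨hl, he⟩⟩)
    · obtain ⟨t', ht', -⟩ := ht.inlines h
      exact .inl ⟨t', ht'⟩
    · obtain ⟨t', hl', ht'⟩ := hl.inlines h
      obtain ⟨as', he', -⟩ := he.inlines ht' .nil
      exact .inr ⟨as', .var hl' he'⟩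
  · rintro (⟨t, ht⟩ | ⟨as, ⟨hl, he⟩⟩)
    · obtain ⟨t', ht', -⟩ := ht.of_inlines h
      exact .inl ⟨t', ht'⟩
    · obtain ⟨t', hl', ht'⟩ := hl.of_inlines h
      obtain ⟨as', he', -⟩ := he.of_inlines ht' .nil
      exact .inr ⟨as', .var hl' he'⟩

theorem LinStep.paths_eq {M N : Term} (h : M.LinStep N) : paths M = paths N :=
  paths_eq_of_inlines h.inlines

end Term

namespace Term

/-! ### Iterated abstraction and application -/

def lams : ℕ → Term → Term
  | 0, t => t
  | n + 1, t => lam (lams n t)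

def apps : Term → List Term → Term
  | t, [] => t
  | t, v :: vs => apps (app t v) vs

theorem apps_append (t : Term) (us vs : List Term) : t.apps (us ++ vs) = (t.apps us).apps vs := by
  induction us generalizing t with
  | nil => rfl
  | cons u us ih => exact ih _

/-- The arguments `val 1, …, val h`. -/
def argList (val : ℕ → Term) (h : ℕ) : List Term := (List.range h).map fun j => val (j + 1)

@[simp] theorem argList_zero (val : ℕ → Term) : argList val 0 = [] := rfl

theorem argList_succ (val : ℕ → Term) (h : ℕ) :
    argList val (h + 1) = val 1 :: argList (fun j => val (j + 1)) h := by
  simp [argList, List.range_succ_eq_map]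

theorem getElem?_argList (val : ℕ → Term) (h i : ℕ) :
    (argList val h)[i]? = if i < h then some (val (i + 1)) else none := by
  simp only [argList, List.getElem?_map]
  split_ifs with hi
  · simp [List.getElem?_range hi]
  · simp [hi]

theorem evals_apps {p k x c : ℕ} {h : Term} {us π as : List Term} {σ : ℕ → Term} :
    Evals p k ((h.apps us).subst σ) π x as c ↔
      ∃ c', c = c' + us.length ∧ Evals p k (h.subst σ) (us.map (·.subst σ) ++ π) x as c' := by
  induction us generalizing h c with
  | nil => simp [apps]
  | cons u us ih =>
    simp only [apps, ih, List.length_cons, List.map_cons, List.cons_append]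
    constructor
    · rintro ⟨c', rfl, hc⟩
      cases hc with
      | app hc => exact ⟨_, by omega, hc⟩
    · rintro ⟨c', rfl, hc⟩
      exact ⟨c' + 1, by omega, .app hc⟩

/-- Of the `n` abstractions, as many as there are pending arguments are removed by β-steps and the
others open as bound names of the external lambda. By `hname` the sequence `val` goes on with
exactly these names after the arguments, so one environment covers both cases. Index `i` refers to
place `n - i` because indices count from the inside and places from the outside. -/
theorem evals_lams {p n h k x c : ℕ} {X : Term} {val σ : ℕ → Term} {as : List Term}
    (hname : ∀ j, val (h + j + 1) = var (name p (.idx (k + j + 1)))) :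
    Evals p k ((lams n X).subst σ) (argList val h) x as c ↔
      ∃ c', c = c' + n ∧
        Evals p (k + (n - h)) (X.subst fun i => if i < n then val (n - i) else σ (i - n))
          (argList (fun j => val (n + j)) (h - n)) x as c' := by
  induction n generalizing val h k σ c with
  | zero => simp [lams]
  | succ n ih =>
    have key : ∀ a : Term, val 1 = a →
        (fun i => if i < n then val (n - i + 1) else scons a σ (i - n)) =
          fun i => if i < n + 1 then val (n + 1 - i) else σ (i - (n + 1)) := by
      rintro a rfl
      funext i
      rcases lt_trichotomy i n with hi | rfl | hi
      · simp only [hi, if_true, show i < n + 1 by omega]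
        congr 1; omega
      · simp
      · obtain ⟨d, rfl⟩ := Nat.exists_eq_add_of_lt hi
        simp [show ¬ n + d + 1 < n by omega, show n + d + 1 - n = d + 1 by omega,
          show n + d + 1 - (n + 1) = d by omega]
    cases h with
    | zero =>
      have h1 : val 1 = var (name p (.idx (k + 1))) := by simpa using hname 0
      have := @ih 0 (k + 1) (c - 1) (fun j => val (j + 1))
        (scons (var (name p (.idx (k + 1)))) σ)
        (by intro j; have := hname (j + 1); simp only [← add_assoc] at this ⊢
            rw [this]; congr 3; omega)
      simp only [argList_zero, lams, subst, Nat.zero_sub, Nat.sub_zero, key _ h1] at this ⊢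
      constructor
      · intro hc
        cases hc with
        | lam hc =>
          rw [subst_lift_inst] at hc
          obtain ⟨c', h, hc⟩ := this.1 hc
          refine ⟨c', by omega, ?_⟩
          rwa [show k + (n + 1) = k + 1 + n by omega]
      · rintro ⟨c', rfl, hc⟩
        refine .lam ?_
        rw [subst_lift_inst]
        refine this.2 ⟨c', by omega, ?_⟩
        rwa [show k + (n + 1) = k + 1 + n by omega] at hc
    | succ h =>
      have := @ih h k (c - 1) (fun j => val (j + 1)) (scons (val 1) σ)
        (by intro j; rw [← hname]; congr 1; omega)
      simp only [argList_succ, lams, subst, Nat.add_sub_add_right, key _ rfl] at this ⊢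
      have e : (fun j => val (n + 1 + j)) = fun j => val (n + j + 1) := by
        funext j; congr 1; omega
      rw [e]
      constructor
      · intro hc
        cases hc with
        | beta hc =>
          rw [subst_lift_inst] at hc
          obtain ⟨c', h, hc⟩ := this.1 hc
          exact ⟨c', by omega, hc⟩
      · rintro ⟨c', rfl, hc⟩
        refine .beta ?_
        rw [subst_lift_inst]
        exact this.2 ⟨c', by omega, hc⟩

end Term

/-! ### Terms of computation trees -/

namespace CTree

mutual
/-- The term of a computation tree. -/
def toTerm : CTree → Term
  | node n (some i) cs => Term.lams n (Term.apps (.var i) (toTerms cs))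
  -- A junk value: such a tree is not `Proper`.
  | node n none [] => Term.lams n (.var 0)
  | node n none (c :: cs) => Term.lams n (Term.apps (toTerm c) (toTerms cs))
def toTerms : List CTree → List Term
  | [] => []
  | c :: cs => toTerm c :: toTerms cs
end

theorem toTerms_eq_map (cs : List CTree) : toTerms cs = cs.map toTerm := by
  induction cs with
  | nil => rfl
  | cons c cs ih => simp [toTerms, ih]

/-- Every `@`-node has an operator and at least one operand. -/
inductive Proper : CTree → Prop
  | node {n : ℕ} {h : Option ℕ} {cs : List CTree} :
      (h = none → 2 ≤ cs.length) → (∀ c ∈ cs, Proper c) → Proper (node n h cs)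

end CTree

theorem Term.proper_ctree (M : Term) : M.ctree.Proper := by
  induction M with
  | var i => exact .node (by simp) (by simp)
  | lam t ih =>
    simp only [Term.ctree]
    split
    next n h cs e => rw [e] at ih; cases ih with | node h1 h2 => exact .node h1 h2
  | app u v hu hv =>
    simp only [Term.ctree]
    split
    next h cs e =>
      rw [e] at hu
      cases hu with
      | node h1 h2 =>
        refine .node (fun h => ?_) ?_
        · have := h1 h; simp; omega
        · intro c hc
          rcases List.mem_append.1 hc with hc | hc
          · exact h2 c hc
          · rw [List.mem_singleton.1 hc]; exact hv
    next n h cs e =>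
      rw [e] at hu
      refine .node (by simp) ?_
      simp [hu, hv]

theorem Term.toTerm_ctree (M : Term) : M.ctree.toTerm = M := by
  induction M with
  | var i => rfl
  | lam t ih =>
    simp only [Term.ctree]
    split
    next n h cs e =>
      rw [e] at ih
      rw [← ih]
      match h, cs with
      | some i, cs => rfl
      | none, [] => rfl
      | none, c :: cs => rfl
  | app u v hu hv =>
    have hp := u.proper_ctree
    simp only [Term.ctree]
    split
    next h cs e =>
      rw [e] at hu hp
      rw [← hu]
      match h, cs with
      | some i, cs =>
        simp [CTree.toTerm, Term.lams, CTree.toTerms_eq_map, Term.apps_append, hv, Term.apps]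
      | none, [] => cases hp with | node h1 => simp at h1
      | none, c :: cs =>
        simp [CTree.toTerm, Term.lams, CTree.toTerms_eq_map, Term.apps_append, hv, Term.apps]
    next n h cs e =>
      rw [e] at hu
      simp [CTree.toTerm, CTree.toTerms, Term.lams, hu, hv, Term.apps]

namespace CTree

variable {T : CTree}

theorem Proper.child {t c : CTree} {k : ℕ} (h : t.Proper) (hc : t.child k = some c) :
    c.Proper := by
  cases h with
  | @node n h cs h1 h2 =>
    cases h with
    | none => exact h2 c (List.mem_of_getElem? hc)
    | some i =>
      cases k with
      | zero => simp [CTree.child] at hc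
      | succ k => exact h2 c (List.mem_of_getElem? hc)

theorem Proper.sub {t : CTree} {a : List ℕ} (h : T.Proper) (ht : T.sub a = some t) :
    t.Proper := by
  induction a generalizing T with
  | nil => simp only [CTree.sub, Option.some.injEq] at ht; exact ht ▸ h
  | cons k a ih =>
    obtain ⟨c, hc, hs⟩ := Option.bind_eq_some_iff.1 ht
    exact ih (h.child hc) hs

theorem sub_append (a b : List ℕ) : T.sub (a ++ b) = (T.sub a).bind (·.sub b) := by
  induction a generalizing T with
  | nil => simp [sub]
  | cons k a ih =>
    simp only [List.cons_append, sub, Option.bind_assoc]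
    congr 1; funext c; exact ih

theorem sub_concat {a : List ℕ} {k : ℕ} {t : CTree} (h : T.sub a = some t) :
    T.sub (a ++ [k]) = t.child k := by
  simp [sub_append, h, sub]

/-! ### Enabling -/

@[simp] theorem kind_lam (a : List ℕ) : T.kind (.lam a) = .lam := rfl
@[simp] theorem kind_ghostLam (m : TNode) (k : ℕ) : T.kind (.ghostLam m k) = .lam := rfl
@[simp] theorem kind_ghostVar (m : TNode) (k : ℕ) : T.kind (.ghostVar m k) = .var := rfl

theorem kind_body_ne_lam (a : List ℕ) : T.kind (.body a) ≠ .lam := by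
  simp only [kind]; split_ifs <;> simp

theorem kind_body_of_head {a : List ℕ} {t : CTree} {i : ℕ} (h : T.sub a = some t)
    (hi : t.head = some i) : T.kind (.body a) = .var := by
  simp [kind, h, hi]

theorem Enables.kind_eq_lam_iff {m n : TNode} {ℓ : Link} (h : T.Enables m ℓ n) :
    T.kind m = .lam ↔ T.kind n ≠ .lam := by
  cases h with
  | child => simp [kind_body_ne_lam]
  | bound => simp [kind_body_ne_lam]
  | free => simp [kind_body_ne_lam]
  | ghostLam h => simp [h]
  | ghostVar h => simp [h]

theorem Enables.kind_ne_app {m n : TNode} {ℓ : Link} (h : T.Enables m ℓ n) : T.kind n ≠ .app := by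
  cases h with
  | bound h h1 => simp [kind_body_of_head h h1]
  | free h h1 => simp [kind_body_of_head h h1]
  | _ => simp

/-- The address of a lambda node and the data of a ghost node determine enabler and label. For a
variable, comparing its index with the length of the scope decides between bound and free. -/
theorem Enables.unique {m m' n : TNode} {ℓ ℓ' : Link} (h : T.Enables m ℓ n)
    (h' : T.Enables m' ℓ' n) : m = m' ∧ ℓ = ℓ' := by
  cases h with
  | @child a k _ _ h1 h2 =>
    generalize e : TNode.lam (a ++ [k]) = x at h'
    cases h' with
    | child => simp at e; simp [e]
    | _ => cases e
  | bound h1 h2 h3 =>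
    cases h' with
    | bound h1' h2' h3' =>
      obtain rfl := Option.some.inj (h1.symm.trans h1')
      obtain rfl := Option.some.inj (h2.symm.trans h2')
      have := Option.some.inj (h3.symm.trans h3')
      simp_all
    | free h1' h2' =>
      obtain rfl := Option.some.inj (h1.symm.trans h1')
      obtain rfl := Option.some.inj (h2.symm.trans h2')
      have := (List.getElem?_eq_some_iff.1 h3).1
      simp at this
  | free h1 h2 =>
    cases h' with
    | free h1' h2' =>
      obtain rfl := Option.some.inj (h1.symm.trans h1')
      have := Option.some.inj (h2.symm.trans h2')
      simp_all
    | bound h1' h2' h3 =>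
      obtain rfl := Option.some.inj (h1.symm.trans h1')
      obtain rfl := Option.some.inj (h2.symm.trans h2')
      have := (List.getElem?_eq_some_iff.1 h3).1
      simp at this
  | ghostLam => cases h'; simp
  | ghostVar => cases h'; simp

theorem not_enables_root {m : TNode} {ℓ : Link} : ¬ T.Enables m ℓ (.lam []) := by
  intro h
  generalize e : TNode.lam [] = x at h
  cases h <;> simp at e

theorem child_le_numOperands {t c : CTree} {k : ℕ} (h : t.child k = some c) :
    k ≤ t.numOperands := by
  obtain ⟨n, h', cs⟩ := t
  cases h' with
  | none =>
    have := (List.getElem?_eq_some_iff.1 h).1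
    simp only [numOperands]; omega
  | some i =>
    cases k with
    | zero => simp
    | succ k => exact (List.getElem?_eq_some_iff.1 h).1

theorem exists_child {t : CTree} {k : ℕ} (hk : 1 ≤ k) (h : k ≤ t.numOperands) :
    ∃ c, t.child k = some c := by
  obtain ⟨n, h', cs⟩ := t
  cases h' with
  | none =>
    simp only [numOperands] at h
    exact ⟨cs[k], List.getElem?_eq_getElem (by omega)⟩
  | some i =>
    simp only [numOperands] at h
    obtain ⟨k, rfl⟩ := Nat.exists_eq_add_of_le' hk
    exact ⟨cs[k], List.getElem?_eq_getElem (by omega)⟩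

theorem arity_body {a : List ℕ} {t : CTree} (h : T.sub a = some t) :
    T.arity (.body a) = t.numOperands := by simp [arity, h]

theorem arity_lam {a : List ℕ} {t : CTree} (h : T.sub a = some t) :
    T.arity (.lam a) = t.lamArity := by simp [arity, h]

/-- This fails for lambda nodes, since a bound variable may occur many times. Elsewhere, ghosts and
actual children have disjoint ranges of labels. -/
theorem Enables.unique_target {m n n' : TNode} {ℓ : Link} (h : T.Enables m ℓ n)
    (h' : T.Enables m ℓ n') (hm : T.kind m ≠ .lam) : n = n' := by
  cases h with
  | child h1 h2 =>
    cases h' with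
    | child => rfl
    | ghostLam h3 h4 =>
      have := child_le_numOperands h2
      rw [arity_body h1] at h4; omega
    | ghostVar h3 => exact absurd h3 hm
  | bound => simp at hm
  | free => simp at hm
  | ghostVar h => exact absurd h hm
  | ghostLam h3 h4 =>
    cases h' with
    | child h1 h2 =>
      have := child_le_numOperands h2
      rw [arity_body h1] at h4; omega
    | ghostLam => rfl
    | bound => simp at hm
    | ghostVar h3 => exact absurd h3 hm

/-- Every variable or `@`-node enables a lambda node with each positive label. -/
theorem exists_enables {m : TNode} (hm : T.kind m ≠ .lam) {k : ℕ} (hk : 1 ≤ k) :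
    ∃ β, T.Enables m (.idx k) β := by
  by_cases h : T.arity m < k
  · exact ⟨_, .ghostLam hm h⟩
  · match m with
    | .body a =>
      rcases e : T.sub a with _ | t
      · simp [arity, e] at h; omega
      · rw [arity_body e] at h
        obtain ⟨c, hc⟩ := exists_child hk (Nat.not_lt.1 h)
        exact ⟨_, .child e hc⟩
    | .lam a => simp at hm
    | .ghostLam m k => simp at hm
    | .ghostVar m k => simp [arity] at h; omega

theorem external_root : T.External (.lam []) := .refl

theorem Enables.external_iff {m n : TNode} {ℓ : Link} (h : T.Enables m ℓ n) :
    T.External n ↔ T.External m := by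
  constructor
  · intro hn
    rcases Relation.ReflTransGen.cases_tail hn with e | ⟨m', hm', ℓ', h'⟩
    · subst e; exact absurd h not_enables_root
    · exact (h.unique h').1 ▸ hm'
  · intro hm
    exact hm.tail ⟨_, h⟩

theorem not_external_app {n : TNode} (h : T.kind n = .app) : ¬ T.External n := by
  intro hn
  rcases Relation.ReflTransGen.cases_tail hn with e | ⟨m', hm', ℓ', h'⟩
  · rw [e] at h; simp at h
  · exact h'.kind_ne_app h

/-! ### Scopes -/

theorem scopeFrom_concat {pre a : List ℕ} {k : ℕ} {t : CTree}
    (h : T.sub (a ++ [k]) = some t) :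
    T.scopeFrom pre (a ++ [k]) = T.scopeFrom pre a ++ bulkNames (pre ++ a ++ [k]) t.lamArity := by
  induction a generalizing T pre with
  | nil =>
    obtain ⟨c, hc, hs⟩ := Option.bind_eq_some_iff.1 h
    simp only [sub, Option.some.injEq] at hs
    simp [scopeFrom, hc, hs]
  | cons j a ih =>
    obtain ⟨c, hc, hs⟩ := Option.bind_eq_some_iff.1 h
    simp [scopeFrom, hc, ih hs]

theorem scope_concat {a : List ℕ} {k : ℕ} {t : CTree} (h : T.sub (a ++ [k]) = some t) :
    T.scope (a ++ [k]) = T.scope a ++ bulkNames (a ++ [k]) t.lamArity := by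
  simpa [scope] using scopeFrom_concat (pre := []) h

theorem getElem?_reverse_bulkNames (a : List ℕ) {n j : ℕ} (h : j < n) :
    (bulkNames a n).reverse[j]? = some (a, n - j) := by
  rw [List.getElem?_reverse (by simpa [bulkNames] using h)]
  simp only [bulkNames, List.length_map, List.length_range, List.getElem?_map]
  rw [List.getElem?_range (by omega)]
  simp; omega

theorem length_bulkNames (a : List ℕ) (n : ℕ) : (bulkNames a n).length = n := by simp [bulkNames]

end CTree

namespace CTree

variable {T : CTree}

/-! ### Local structure of normalizing traversals -/

theorem drop_of_getElem? {α : Type*} {l : List α} {d : ℕ} {x : α} (h : l[d]? = some x) :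
    l.drop d = x :: l.drop (d + 1) := by
  obtain ⟨hd, rfl⟩ := List.getElem?_eq_some_iff.1 h
  exact List.drop_eq_getElem_cons hd

theorem getElem?_of_drop {α : Type*} {l l' : List α} {d k : ℕ} (h : l.drop d = l') :
    l[d + k]? = l'[k]? := by
  rw [← h, List.getElem?_drop]

theorem NormTrav.tail {o p : Occ} {t : JSeq} (h : T.NormTrav (o :: p :: t)) :
    T.NormTrav (p :: t) := by
  cases h <;> assumption

theorem NormTrav.drop {s : JSeq} (h : T.NormTrav s) {d : ℕ} {j : Occ} {t : JSeq}
    (hd : s.drop d = j :: t) : T.NormTrav (j :: t) := by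
  induction d generalizing s with
  | zero => simpa using hd ▸ h
  | succ d ih =>
    match s, hd with
    | o :: p :: s, hd => exact ih h.tail hd
    | [o], hd => simp at hd
    | [], hd => simp at hd

theorem Enables.label_idx {m n : TNode} {ℓ : Link} (h : T.Enables m ℓ n)
    (hm : T.kind m ≠ .lam) : ∃ k, ℓ = .idx k := by
  cases h <;> simp_all

/-- What the rules guarantee for the last occurrence of a normalizing traversal. -/
structure LastOcc (T : CTree) (o : Occ) (t : JSeq) : Prop where
  justified : o.dist ≠ 0 → ∃ d j t', o.dist = d + 1 ∧ t.drop d = j :: t' ∧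
    T.Enables j.node o.label o.node
  unjustified : o.dist = 0 → T.kind o.node = .app ∨ (o.node = .lam [] ∧ t = [])
  after_lam : T.kind o.node ≠ .lam → ∃ p t', t = p :: t' ∧ T.kind p.node = .lam ∧
    ∀ a, o.node = .body a → p.node = .lam a
  after_body : T.kind o.node = .lam → t = [] ∨ ∃ p t', t = p :: t' ∧ T.kind p.node ≠ .lam ∧
    (T.External o.node ↔ T.External p.node)
  defined : ∀ a, o.node = .lam a ∨ o.node = .body a → ∃ u, T.sub a = some u

theorem Enables.defined {m n : TNode} {ℓ : Link} (h : T.Enables m ℓ n) {a : List ℕ}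
    (ha : n = .lam a ∨ n = .body a) : ∃ u, T.sub a = some u := by
  cases h with
  | child h1 h2 =>
    rcases ha with ha | ha <;> simp only [TNode.lam.injEq, reduceCtorEq] at ha
    exact ⟨_, ha ▸ (sub_concat h1).trans h2⟩
  | bound h1 =>
    rcases ha with ha | ha <;> simp only [TNode.body.injEq, reduceCtorEq] at ha
    exact ⟨_, ha ▸ h1⟩
  | free h1 =>
    rcases ha with ha | ha <;> simp only [TNode.body.injEq, reduceCtorEq] at ha
    exact ⟨_, ha ▸ h1⟩
  | ghostLam => simp at ha
  | ghostVar => simp at ha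

/-- The rules (Ghost Lam) and (Var) look at an earlier justifier and at its predecessor, hence
strong induction on the length. -/
theorem NormTrav.lastOcc {o : Occ} {t : JSeq} (h : T.NormTrav (o :: t)) : LastOcc T o t := by
  induction hn : t.length using Nat.strong_induction_on generalizing o t with
  | _ n ih =>
  subst hn
  have hsub : ∀ {p : Occ} {t' : JSeq} {d : ℕ} {j : Occ} {t'' : JSeq}, t = p :: t' →
      (p :: t').drop d = j :: t'' → T.NormTrav (j :: t'') ∧ LastOcc T j t'' := by
    rintro p t' d j t'' rfl hd
    have hj : T.NormTrav (j :: t'') := h.tail.drop hd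
    refine ⟨hj, ih _ ?_ hj rfl⟩
    have := congrArg List.length hd
    simp at this ⊢; omega
  cases h with
  | root =>
    exact ⟨by simp, by simp, by simp, by simp, by
      intro a ha
      simp only [TNode.lam.injEq, reduceCtorEq, or_false] at ha
      exact ⟨T, ha ▸ rfl⟩⟩
  | @app o t α h0 hk he =>
    have hα : T.kind α = .lam := by
      by_contra hc; rw [he.kind_eq_lam_iff.2 hc] at hk; simp at hk
    refine ⟨fun _ => ⟨0, o, t, rfl, rfl, he⟩, by simp, by simp [hα],
      fun _ => .inr ⟨o, t, rfl, by simp [hk], he.external_iff⟩, fun a ha => he.defined ha⟩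
  | @lamApp o t a h0 ho hk =>
    refine ⟨by simp, fun _ => .inl hk, fun _ => ⟨o, t, rfl, by simp [ho], ?_⟩, ?_, ?_⟩
    · intro b hb; simp only [TNode.body.injEq] at hb; rw [ho, hb]
    · intro h; simp [hk] at h
    · intro b hb
      simp only [TNode.body.injEq, reduceCtorEq, false_or] at hb
      exact (hsub (d := 0) rfl rfl).2.defined b (.inl (hb ▸ ho))
  | @lamVar o β t a d ℓ h0 ho hk hd hv he =>
    refine ⟨fun _ => ⟨d, β, _, rfl, drop_of_getElem? hd, he⟩, by simp,
      fun _ => ⟨o, t, rfl, by simp [ho], ?_⟩, ?_, fun a ha => he.defined ha⟩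
    · intro b hb; simp only [TNode.body.injEq] at hb; rw [ho, hb]
    · intro h; simp [hk] at h
  | @lamGhost o m α t m₀ k₀ i h0 ho hi hm hα =>
    have hl := (hsub (d := 0) rfl rfl).2
    have hd : o.dist ≠ 0 := by
      intro hd
      rcases hl.unjustified hd with h | h <;> simp [ho] at h
    obtain ⟨d, j, t', hd', hj, he⟩ := hl.justified hd
    -- The occurrences that the rule fetches by position are the justifier of `o` and the
    -- predecessor of that justifier.
    have hm' := drop_of_getElem? hm
    have hα' := drop_of_getElem? hα
    have hα₂ := hα'
    rw [hd'] at hα₂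
    rw [hd', List.drop_succ_cons, hj, hα₂] at hm'
    simp only [List.cons.injEq] at hm'
    obtain ⟨rfl, rfl⟩ := hm'
    have hjl := (hsub (d := d + 1) rfl (by simpa using hj)).2
    rw [ho, hi] at he
    generalize e : TNode.ghostLam m₀ k₀ = x at he
    generalize e' : j.node = y at he
    generalize e'' : Link.idx i = ℓ at he
    cases he with
    | ghostLam h1 h2 =>
      simp only [Link.idx.injEq, TNode.ghostLam.injEq] at e e''
      subst e' e''
      obtain ⟨p, t₂, ht₂, hp, -⟩ := hjl.after_lam h1
      simp only [List.cons.injEq] at ht₂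
      obtain ⟨rfl, -⟩ := ht₂
      -- The label `i` of the ghost lambda exceeds `|m|`, so `|α| + i - |m|` is an exact subtraction
      -- and exceeds `|α|`, as a ghost variable requires.
      refine ⟨fun _ => ⟨o.dist + 1, α, _, rfl, hα', .ghostVar hp (by omega)⟩, by simp,
        fun _ => ⟨o, t, rfl, by simp [ho], by simp⟩, by simp, by simp⟩
    | _ => simp at e
  | @var o m α t i β h0 hk hx hi hi0 hα hm he =>
    have hl := (hsub (d := 0) rfl rfl).2
    have hd : o.dist ≠ 0 := by
      intro hd
      rcases hl.unjustified hd with h | h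
      · simp [hk] at h
      · simp [h.1] at hk
    obtain ⟨d, j, t', hd', hj, he'⟩ := hl.justified hd
    have hα' := drop_of_getElem? hα
    have hm' := drop_of_getElem? hm
    have hm₂ := hm'
    rw [hd'] at hm₂
    rw [hd', List.drop_succ_cons, hj, hm₂] at hα'
    simp only [List.cons.injEq] at hα'
    obtain ⟨rfl, rfl⟩ := hα'
    have hjl := (hsub (d := d + 1) rfl (by simpa using hj)).2
    have hjk : T.kind j.node = .lam := he'.kind_eq_lam_iff.2 (by simp [hk])
    rcases hjl.after_body hjk with h | ⟨p, t₂, ht₂, hp, hx'⟩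
    · simp at h
    · simp only [List.cons.injEq] at ht₂
      obtain ⟨rfl, -⟩ := ht₂
      have hβ : T.kind β = .lam := by
        by_contra hc; exact hp (he.kind_eq_lam_iff.2 hc)
      refine ⟨fun _ => ⟨o.dist + 1, m, _, rfl, hm', he⟩, by simp, by simp [hβ], fun _ =>
        .inr ⟨o, t, rfl, by simp [hk], ?_⟩, fun a ha => he.defined ha⟩
      -- Externality passes from `β` to its enabler `m`, from there to the lambda after `m`, and on
      -- to the variable that this lambda enables.
      rw [he.external_iff, ← hx', ← he'.external_iff]
  | @ivar o t i α h0 hk hx he hi1 hi2 =>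
    have hα : T.kind α = .lam := by
      by_contra hc; rw [he.kind_eq_lam_iff.2 hc] at hk; simp at hk
    refine ⟨fun _ => ⟨0, o, t, rfl, rfl, he⟩, by simp, by simp [hα],
      fun _ => .inr ⟨o, t, rfl, by simp [hk], he.external_iff⟩, fun a ha => he.defined ha⟩

theorem NormTrav.var_binder {o : Occ} {t : JSeq} (h : T.NormTrav (o :: t))
    (ho : T.kind o.node = .var) : ∃ d j t', o.dist = d + 1 ∧ t.drop d = j :: t' ∧
      T.Enables j.node o.label o.node ∧ T.kind j.node = .lam ∧ T.NormTrav (j :: t') := by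
  obtain ⟨d, j, t', hd, hj, he⟩ := h.lastOcc.justified (by
    intro hd
    rcases h.lastOcc.unjustified hd with h | h
    · simp [ho] at h
    · simp [h.1] at ho)
  exact ⟨d, j, t', hd, hj, he, he.kind_eq_lam_iff.2 (by simp [ho]),
    h.drop (d := d + 1) (by simpa using hj)⟩

theorem NormTrav.lam_parent {o : Occ} {t : JSeq} (h : T.NormTrav (o :: t))
    (ho : T.kind o.node = .lam) (hd : o.dist ≠ 0) : ∃ d j p t' k, o.dist = d + 1 ∧
      o.label = .idx k ∧ t.drop d = j :: p :: t' ∧ T.Enables j.node (.idx k) o.node ∧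
      T.kind j.node ≠ .lam ∧ T.kind p.node = .lam ∧ T.NormTrav (j :: p :: t') := by
  obtain ⟨d, j, t', hd, hj, he⟩ := h.lastOcc.justified hd
  have hjt : T.NormTrav (j :: t') := h.drop (d := d + 1) (by simpa using hj)
  have hjk : T.kind j.node ≠ .lam := fun hc => he.kind_eq_lam_iff.1 hc ho
  obtain ⟨p, t₂, rfl, hp, -⟩ := hjt.lastOcc.after_lam hjk
  obtain ⟨k, hk⟩ := he.label_idx hjk
  exact ⟨d, j, p, t₂, k, hd, hk, hj, hk ▸ he, hjk, hp, hjt⟩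

/-- The justifier of a non-root lambda node of the tree is its parent, preceded by the lambda node
one level up. Inductions along the P-view rest on this. -/
theorem NormTrav.lam_cases {o : Occ} {t : JSeq} {a : List ℕ} (h : T.NormTrav (o :: t))
    (ho : o.node = .lam a) : (a = [] ∧ t = [] ∧ o.dist = 0) ∨
      ∃ a' c d j o' t', a = a' ++ [c] ∧ o.dist = d + 1 ∧ o.label = .idx c ∧
        t.drop d = j :: o' :: t' ∧ j.node = .body a' ∧ o'.node = .lam a' ∧
        T.NormTrav (j :: o' :: t') ∧ ∃ u c', T.sub a' = some u ∧ u.child c = some c' := by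
  have hl := h.lastOcc
  by_cases hd : o.dist = 0
  · rcases hl.unjustified hd with h | ⟨h1, h2⟩
    · simp [ho] at h
    · rw [ho] at h1; simp only [TNode.lam.injEq] at h1; exact .inl ⟨h1, h2, hd⟩
  · right
    obtain ⟨d, j, t', hd', hj, he⟩ := hl.justified hd
    have hjt : T.NormTrav (j :: t') := h.drop (d := d + 1) (by simpa using hj)
    rw [ho] at he
    generalize e : TNode.lam a = x at he
    generalize e2 : j.node = y at he
    generalize e3 : o.label = ℓ at he
    cases he with
    | child h1 h2 =>
      simp only [TNode.lam.injEq] at e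
      obtain ⟨p, t₂, rfl, -, hp⟩ := hjt.lastOcc.after_lam (by rw [e2]; exact kind_body_ne_lam _)
      exact ⟨_, _, d, j, p, t₂, e, hd', rfl, hj, e2, hp _ e2, hjt, _, _, h1, h2⟩
    | _ => simp at e

-- P-views as paths of the tree

theorem visible_lam_iff {o j o' : Occ} {t t' : JSeq} {d e : ℕ} (ho : T.kind o.node = .lam)
    (hd : o.dist = d + 1) (ht : t.drop d = j :: o' :: t') (hj : T.kind j.node ≠ .lam) :
    T.Visible (o :: t) e ↔ e = 0 ∨ e = d + 1 ∨ ∃ k, e = d + 2 + k ∧ T.Visible (o' :: t') k := by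
  constructor
  · intro h
    cases h with
    | last => exact .inl rfl
    | nonlam h => exact absurd ho h
    | @lam _ _ d' k _ hd' hv =>
      obtain rfl : d' = d := by omega
      rw [ht] at hv
      cases hv with
      | last => exact .inr (.inl (by omega))
      | @nonlam _ _ k _ hv => exact .inr (.inr ⟨k, by omega, hv⟩)
      | lam h => exact absurd h hj
  · rintro (rfl | rfl | ⟨k, rfl, hv⟩)
    · exact .last
    · have := Visible.lam (t := t) (k := 0) ho hd (ht ▸ .last)
      simpa using this
    · have := Visible.lam (t := t) (k := k + 1) ho hd (ht ▸ .nonlam hj hv)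
      rwa [show d + 2 + k = k + 1 + (d + 1) by omega]

theorem visible_root {o : Occ} {e : ℕ} (ho : T.kind o.node = .lam) (hd : o.dist = 0) :
    T.Visible [o] e ↔ e = 0 := by
  constructor
  · intro h
    cases h with
    | last => rfl
    | nonlam h => exact absurd ho h
    | lam _ h => omega
  · rintro rfl; exact .last

theorem getElem?_cons_drop {o j o' : Occ} {t t' : JSeq} {d : ℕ}
    (ht : t.drop d = j :: o' :: t') (k : ℕ) : (o :: t)[d + 2 + k]? = (o' :: t')[k]? := by
  have := getElem?_of_drop (k := k + 1) ht
  rw [show d + 2 + k = d + (k + 1) + 1 by omega, List.getElem?_cons_succ, this]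
  simp

theorem length_lt_of_drop {t t' : JSeq} {d : ℕ} {j o' : Occ} (ht : t.drop d = j :: o' :: t') :
    t'.length < t.length := by
  have := congrArg List.length ht
  simp at this; omega

/-- Passing from a lambda to the occurrence before its justifier goes one level up in the tree, so
the P-view retraces the path from the root. -/
theorem NormTrav.visible_prefix {o : Occ} {t : JSeq} {a : List ℕ} (h : T.NormTrav (o :: t))
    (ho : o.node = .lam a) {e : ℕ} {β : Occ} {b : List ℕ} (hv : T.Visible (o :: t) e)
    (hβ : (o :: t)[e]? = some β) (hb : β.node = .lam b) : b <+: a := by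
  induction hn : t.length using Nat.strong_induction_on generalizing o t a e with
  | _ n ih =>
  subst hn
  rcases h.lam_cases ho with ⟨rfl, rfl, hd⟩ | ⟨a', c, d, j, o', t', rfl, hd, -, ht, hj, ho', hj', -⟩
  · rw [visible_root (by simp [ho]) hd] at hv
    subst hv
    simp only [List.getElem?_cons_zero, Option.some.injEq] at hβ
    subst hβ
    rw [ho] at hb; simp only [TNode.lam.injEq] at hb; rw [← hb]
  · have hjk : T.kind j.node ≠ .lam := by rw [hj]; exact kind_body_ne_lam _
    rcases (visible_lam_iff (by simp [ho]) hd ht hjk).1 hv with rfl | rfl | ⟨k, rfl, hv₂⟩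
    · simp only [List.getElem?_cons_zero, Option.some.injEq] at hβ
      subst hβ
      rw [ho] at hb; simp only [TNode.lam.injEq] at hb; rw [← hb]
    · rw [List.getElem?_cons_succ, ← Nat.add_zero d, getElem?_of_drop ht] at hβ
      simp only [List.getElem?_cons_zero, Option.some.injEq] at hβ
      subst hβ
      rw [hj] at hb; simp at hb
    · rw [getElem?_cons_drop ht] at hβ
      exact (ih _ (length_lt_of_drop ht) hj'.tail ho' hv₂ hβ rfl).trans (List.prefix_append _ _)

theorem not_concat_prefix (a : List ℕ) (c : ℕ) : ¬ a ++ [c] <+: a := by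
  intro h
  have := h.length_le
  simp at this

/-- Addresses of lambda nodes get strictly shorter along the P-view, so none is repeated. This makes
the pointer in rule (Lam) unique. -/
theorem NormTrav.visible_unique {o : Occ} {t : JSeq} {a : List ℕ} (h : T.NormTrav (o :: t))
    (ho : o.node = .lam a) {e e' : ℕ} {β β' : Occ} {b : List ℕ} (hv : T.Visible (o :: t) e)
    (hβ : (o :: t)[e]? = some β) (hb : β.node = .lam b) (hv' : T.Visible (o :: t) e')
    (hβ' : (o :: t)[e']? = some β') (hb' : β'.node = .lam b) : e = e' := by
  induction hn : t.length using Nat.strong_induction_on generalizing o t a e e' with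
  | _ n ih =>
  subst hn
  rcases h.lam_cases ho with ⟨rfl, rfl, hd⟩ | ⟨a', c, d, j, o', t', rfl, hd, -, ht, hj, ho', hj', -⟩
  · rw [visible_root (by simp [ho]) hd] at hv hv'
    rw [hv, hv']
  · have hjk : T.kind j.node ≠ .lam := by rw [hj]; exact kind_body_ne_lam _
    have key : ∀ {e : ℕ} {β : Occ}, T.Visible (o :: t) e → (o :: t)[e]? = some β →
        β.node = .lam b → (e = 0 ∧ b = a' ++ [c]) ∨
        ∃ k, e = d + 2 + k ∧ T.Visible (o' :: t') k ∧ (o' :: t')[k]? = some β ∧ b <+: a' := by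
      intro e β hv hβ hb
      rcases (visible_lam_iff (by simp [ho]) hd ht hjk).1 hv with rfl | rfl | ⟨k, rfl, hv₂⟩
      · simp only [List.getElem?_cons_zero, Option.some.injEq] at hβ
        subst hβ
        rw [ho] at hb; simp only [TNode.lam.injEq] at hb; exact .inl ⟨rfl, hb.symm⟩
      · rw [List.getElem?_cons_succ, ← Nat.add_zero d, getElem?_of_drop ht] at hβ
        simp only [List.getElem?_cons_zero, Option.some.injEq] at hβ
        subst hβ
        rw [hj] at hb; simp at hb
      · rw [getElem?_cons_drop ht] at hβ
        exact .inr ⟨k, rfl, hv₂, hβ, hj'.tail.visible_prefix ho' hv₂ hβ hb⟩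
    rcases key hv hβ hb with ⟨rfl, rfl⟩ | ⟨k, rfl, hk, hkβ, hp⟩ <;>
      rcases key hv' hβ' hb' with ⟨rfl, h2⟩ | ⟨k', rfl, hk', hkβ', hp'⟩
    · rfl
    · exact absurd hp' (not_concat_prefix _ _)
    · exact absurd (h2 ▸ hp) (not_concat_prefix _ _)
    · rw [ih _ (length_lt_of_drop ht) hj'.tail ho' hk hkβ hk' hkβ' rfl]

theorem NormTrav.exists_visible {o : Occ} {t : JSeq} {a b : List ℕ} (h : T.NormTrav (o :: t))
    (ho : o.node = .lam a) (hb : b <+: a) :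
    ∃ e β, T.Visible (o :: t) e ∧ (o :: t)[e]? = some β ∧ β.node = .lam b := by
  induction hn : t.length using Nat.strong_induction_on generalizing o t a with
  | _ n ih =>
  subst hn
  by_cases hab : b = a
  · exact ⟨0, o, .last, rfl, hab ▸ ho⟩
  rcases h.lam_cases ho with ⟨rfl, rfl, hd⟩ | ⟨a', c, d, j, o', t', rfl, hd, -, ht, hj, ho', hj', -⟩
  · exact absurd (List.prefix_nil.1 hb) hab
  · have hjk : T.kind j.node ≠ .lam := by rw [hj]; exact kind_body_ne_lam _
    have hb' : b <+: a' := by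
      rcases List.prefix_concat_iff.1 hb with h | h
      · exact absurd h hab
      · exact h
    obtain ⟨e, β, hv, hβ, hn⟩ := ih _ (length_lt_of_drop ht) hj'.tail ho' hb' rfl
    exact ⟨d + 2 + e, β, (visible_lam_iff (by simp [ho]) hd ht hjk).2 (.inr (.inr ⟨e, rfl, hv⟩)),
      by rw [getElem?_cons_drop ht, hβ], hn⟩

/-! ### Determinism -/

theorem Enables.body_source {m : TNode} {ℓ : Link} {a : List ℕ}
    (h : T.Enables m ℓ (.body a)) : ∃ b, m = .lam b := by
  cases h <;> exact ⟨_, rfl⟩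

/-- Only rule (IVar) offers a choice, and the choice is its label. In (Lam) the enabler occurs once
in the P-view; in (App), (Var) and (IVar) enabler and label fix the target. -/
theorem NormTrav.step_unique {o o' p : Occ} {t : JSeq} (h : T.NormTrav (o :: p :: t))
    (h' : T.NormTrav (o' :: p :: t))
    (hl : T.kind p.node = .var → T.External p.node → o.label = o'.label) : o = o' := by
  cases h with
  | app _ hk he =>
    cases h' with
    | app _ _ he' => rw [he.unique_target he' (by simp [hk])]
    | _ => simp_all
  | lamApp _ ho hk =>
    cases h' with
    | lamApp _ ho' =>
      have e := ho.symm.trans ho'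
      simp only [TNode.lam.injEq] at e
      rw [e]
    | _ => simp_all
  | lamVar h0 ho hk hd hv he =>
    cases h' with
    | lamVar _ ho' _ hd' hv' he' =>
      have e := ho.symm.trans ho'
      simp only [TNode.lam.injEq] at e
      subst e
      obtain ⟨e1, rfl⟩ := he.unique he'
      obtain ⟨b, hb⟩ := he.body_source
      rw [h0.visible_unique ho hv hd hb hv' hd' (e1 ▸ hb)]
    | _ => simp_all
  | lamGhost =>
    cases h' with
    | lamGhost => simp_all
    | _ => simp_all
  | var h0 hk hx hi hi0 hα hm he =>
    cases h' with
    | var _ _ _ hi' _ _ hm' he' =>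
      have e := hi.symm.trans hi'
      simp only [Link.idx.injEq] at e
      obtain rfl := Option.some.inj (hm.symm.trans hm')
      subst e
      obtain ⟨d, j, t', hd, hj, -, hjk, hjt⟩ := h0.var_binder hk
      rw [hd, List.getElem?_cons_succ, getElem?_of_drop hj] at hm
      rcases hjt.lastOcc.after_body hjk with h | ⟨p, t₂, rfl, hp, -⟩
      · simp [h] at hm
      · simp only [List.getElem?_cons_succ, List.getElem?_cons_zero, Option.some.injEq] at hm
        rw [he.unique_target he' (hm ▸ hp)]
    | _ => simp_all
  | ivar _ hk hx he =>
    cases h' with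
    | ivar _ _ _ he' =>
      have e := hl hk hx
      simp only [Link.idx.injEq] at e
      subst e
      rw [he.unique_target he' (by simp [hk])]
    | _ => simp_all

end CTree

namespace CTree

variable {T : CTree}

/-! ### Reading terms back from traversals -/

/-- What the end of a traversal stands for: the variables bound by a lambda or the arguments of a
variable or `@` (`val`), the values of the variables in scope (`env`), the term under evaluation
(`cur`), the place `pos` of the last external lambda, and the numbers of abstractions and of
arguments that are pending before (`inBinders`, `inHeight`) and after (`binders`, `height`) the
last occurrence. -/
structure Sem where
  arity : ℕ
  pos : ℕ
  inBinders : ℕ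
  inHeight : ℕ
  binders : ℕ
  height : ℕ
  val : ℕ → Term
  env : ℕ → Term
  cur : Term

instance : Inhabited Sem := ⟨⟨0, 0, 0, 0, 0, 0, .var, .var, .var 0⟩⟩

/-- The term of the `k`-th child of a node. -/
def childTerm (T : CTree) : TNode → ℕ → Term
  | .body a, k => (((T.sub a).bind (·.child k)).map toTerm).getD (.var 0)
  | _, _ => .var 0

def freeVal (x : ℕ) : Term := .var (Term.name 1 (.free x))

def linkVal (v : ℕ → Term) : Link → Term
  | .idx k => v k
  | .free x => freeVal x

open Classical in
/-- Number of external occurrences. -/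
noncomputable def extCount (T : CTree) (s : JSeq) : ℕ :=
  s.countP fun p => decide (T.External p.node)

-- Here `p` is the state at the preceding occurrence and `j` the state at the justifier; `o.dist -
-- 1` appears because the drop is taken from the tail. An external lambda binds fresh names, at the
-- place given by the number of external occurrences up to and including it. An internal lambda
-- receives the arguments of the preceding occurrence. Below its own variables a lambda uses the
-- environment of its justifier. A variable or `@`-node offers its children as closures, followed by
-- the arguments that the preceding lambda has left unconsumed.
open Classical in
noncomputable def sem (T : CTree) : JSeq → Sem
  | [] => default
  | o :: t =>
    let p := sem T t
    let j := sem T (t.drop (o.dist - 1))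
    let n := T.arity o.node
    if T.kind o.node = .lam then
      let val := fun k => if T.External o.node then .var (Term.name (T.extCount t + 1) (.idx k))
        else p.val k
      let b := if T.External o.node then 0 else p.binders
      let h := if T.External o.node then 0 else p.height
      { arity := n
        pos := if T.External o.node then T.extCount t + 1 else p.pos
        inBinders := b
        inHeight := h
        binders := b + (n - h)
        height := h - n
        val := val
        env := fun i => if i < n then val (n - i)
          else if o.dist = 0 then freeVal (i - n) else j.env (i - n)
        cur := if o.dist = 0 then T.toTerm.subst freeVal else linkVal j.val o.label }
    else
      let val := fun k => if k ≤ n then (T.childTerm o.node k).subst p.env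
        else p.val (p.arity + (k - n))
      { arity := n
        pos := p.pos
        inBinders := p.binders
        inHeight := n + p.height
        binders := p.binders
        height := n + p.height
        val := val
        env := p.env
        cur := if T.kind o.node = .app then val 0 else linkVal j.val o.label }
  termination_by s => s.length
  decreasing_by all_goals simp

section

variable {o : Occ} {t : JSeq}

theorem sem_arity : (T.sem (o :: t)).arity = T.arity o.node := by
  rw [sem]; split_ifs <;> rfl

theorem sem_lam_external (h : T.kind o.node = .lam) (hx : T.External o.node) :
    (T.sem (o :: t)).pos = T.extCount t + 1 ∧ (T.sem (o :: t)).inBinders = 0 ∧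
    (T.sem (o :: t)).inHeight = 0 ∧
    (∀ k, (T.sem (o :: t)).val k = .var (Term.name (T.extCount t + 1) (.idx k))) := by
  rw [sem]; simp [h, hx]

theorem sem_lam_internal (h : T.kind o.node = .lam) (hx : ¬ T.External o.node) :
    (T.sem (o :: t)).pos = (T.sem t).pos ∧ (T.sem (o :: t)).inBinders = (T.sem t).binders ∧
    (T.sem (o :: t)).inHeight = (T.sem t).height ∧ (T.sem (o :: t)).val = (T.sem t).val := by
  rw [sem]; simp [h, hx]

theorem sem_lam (h : T.kind o.node = .lam) :
    (T.sem (o :: t)).binders =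
      (T.sem (o :: t)).inBinders + (T.arity o.node - (T.sem (o :: t)).inHeight) ∧
    (T.sem (o :: t)).height = (T.sem (o :: t)).inHeight - T.arity o.node ∧
    (∀ i, (T.sem (o :: t)).env i = if i < T.arity o.node then
      (T.sem (o :: t)).val (T.arity o.node - i) else if o.dist = 0 then
      freeVal (i - T.arity o.node) else
      (T.sem (t.drop (o.dist - 1))).env (i - T.arity o.node)) ∧
    ((T.sem (o :: t)).cur = if o.dist = 0 then T.toTerm.subst freeVal else
      linkVal (T.sem (t.drop (o.dist - 1))).val o.label) := by
  rw [sem]; simp [h]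

open Classical in
theorem sem_body (h : T.kind o.node ≠ .lam) :
    (T.sem (o :: t)).pos = (T.sem t).pos ∧ (T.sem (o :: t)).inBinders = (T.sem t).binders ∧
    (T.sem (o :: t)).inHeight = T.arity o.node + (T.sem t).height ∧
    (T.sem (o :: t)).binders = (T.sem t).binders ∧
    (T.sem (o :: t)).height = T.arity o.node + (T.sem t).height ∧
    (T.sem (o :: t)).env = (T.sem t).env ∧
    (∀ k, (T.sem (o :: t)).val k = if k ≤ T.arity o.node then
      (T.childTerm o.node k).subst (T.sem t).env else
      (T.sem t).val ((T.sem t).arity + (k - T.arity o.node))) ∧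
    ((T.sem (o :: t)).cur = if T.kind o.node = .app then (T.sem (o :: t)).val 0 else
      linkVal (T.sem (t.drop (o.dist - 1))).val o.label) := by
  rw [sem]; simp [h]

end

/-- The evaluation that remains to be done at the end of a traversal. -/
def Sem.Evals (S : Sem) (x : ℕ) (as : List Term) (c : ℕ) : Prop :=
  Term.Evals S.pos S.inBinders S.cur (Term.argList S.val S.inHeight) x as c

theorem NormTrav.external_of_singleton {o : Occ} (h : T.NormTrav [o]) :
    T.kind o.node = .lam ∧ T.External o.node := by
  cases h; exact ⟨rfl, external_root⟩

/-- After the pending arguments, `val` continues with the names not yet used of the current external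
lambda. This is the hypothesis `hname` of `Term.evals_lams`. -/
theorem sem_names {o : Occ} {t : JSeq} (h : T.NormTrav (o :: t)) (i : ℕ) :
    (T.kind o.node ≠ .lam → (T.sem (o :: t)).val ((T.sem (o :: t)).height + i + 1) =
      .var (Term.name (T.sem (o :: t)).pos (.idx ((T.sem (o :: t)).binders + i + 1)))) ∧
    (T.kind o.node = .lam → (T.sem (o :: t)).val ((T.sem (o :: t)).inHeight + i + 1) =
      .var (Term.name (T.sem (o :: t)).pos (.idx ((T.sem (o :: t)).inBinders + i + 1)))) := by
  induction t generalizing o i with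
  | nil =>
    obtain ⟨hk, hx⟩ := h.external_of_singleton
    obtain ⟨h1, h2, h3, h4⟩ := sem_lam_external (t := []) hk hx
    simp [hk, h1, h2, h3, h4]
  | cons p t ih =>
    constructor
    · intro hk
      obtain ⟨_, _, e, hp, -⟩ := h.lastOcc.after_lam hk
      simp only [List.cons.injEq] at e
      obtain ⟨rfl, rfl⟩ := e
      obtain ⟨h1, -, -, h4, h5, -, h7, -⟩ := sem_body (t := p :: t) hk
      obtain ⟨g1, g2, -, -⟩ := sem_lam (t := t) hp
      rw [h1, h4, h5, h7, if_neg (by omega), g1, g2, sem_arity,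
        show T.arity p.node + (T.arity o.node + ((T.sem (p :: t)).inHeight - T.arity p.node) + i + 1
          - T.arity o.node) = (T.sem (p :: t)).inHeight +
            (T.arity p.node - (T.sem (p :: t)).inHeight + i) + 1 by omega,
        (ih h.tail _).2 hp]
      congr 3; omega
    · intro hk
      by_cases hx : T.External o.node
      · obtain ⟨h1, h2, h3, h4⟩ := sem_lam_external (t := p :: t) hk hx
        simp [h1, h2, h3, h4]
      · obtain ⟨h1, h2, h3, h4⟩ := sem_lam_internal (t := p :: t) hk hx
        rcases h.lastOcc.after_body hk with e | ⟨_, _, e, hp, -⟩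
        · simp at e
        · simp only [List.cons.injEq] at e
          obtain ⟨rfl, rfl⟩ := e
          rw [h1, h2, h3, h4, (ih h.tail _).1 hp]

theorem sub_of_lam {o : Occ} {t : JSeq} {a : List ℕ} (h : T.NormTrav (o :: t))
    (ho : o.node = .lam a) : ∃ u, T.sub a = some u := h.lastOcc.defined a (.inl ho)

/-- Variables in scope take the values that their binders in the P-view give them. -/
theorem NormTrav.env_bound {o : Occ} {t : JSeq} {a b : List ℕ} {i k : ℕ} (h : T.NormTrav (o :: t))
    (ho : o.node = .lam a) (hi : (T.scope a).reverse[i]? = some (b, k)) :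
    ∃ e β, T.Visible (o :: t) e ∧ (o :: t)[e]? = some β ∧ β.node = .lam b ∧
      (T.sem (o :: t)).env i = (T.sem ((o :: t).drop e)).val k := by
  induction hn : t.length using Nat.strong_induction_on generalizing o t a i with
  | _ n ih =>
  subst hn
  have hk : T.kind o.node = .lam := by simp [ho]
  have henv := (sem_lam (t := t) hk).2.2.1
  rcases h.lam_cases ho with ⟨rfl, rfl, hd⟩ | ⟨a', c, d, j, o', t', rfl, hd, -, ht, hj, ho', hj', -⟩
  · have har : T.arity o.node = T.lamArity := by rw [ho]; exact arity_lam rfl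
    have hlt : i < T.lamArity := by
      have := (List.getElem?_eq_some_iff.1 hi).1
      simpa [scope, scopeFrom, length_bulkNames] using this
    simp only [scope, scopeFrom, getElem?_reverse_bulkNames _ hlt, Option.some.injEq,
      Prod.mk.injEq] at hi
    refine ⟨0, o, .last, rfl, by rw [ho, hi.1], ?_⟩
    rw [henv, har, if_pos hlt, hi.2]; rfl
  · obtain ⟨u, hu⟩ := sub_of_lam h ho
    have har : T.arity o.node = u.lamArity := by rw [ho]; exact arity_lam hu
    rw [scope_concat hu, List.reverse_append] at hi
    by_cases hlt : i < u.lamArity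
    · rw [List.getElem?_append_left (by simpa [length_bulkNames] using hlt),
        getElem?_reverse_bulkNames _ hlt] at hi
      simp only [Option.some.injEq, Prod.mk.injEq] at hi
      refine ⟨0, o, .last, rfl, by rw [ho, hi.1], ?_⟩
      rw [henv, har, if_pos hlt, hi.2]; rfl
    · rw [List.getElem?_append_right (by simpa [length_bulkNames] using hlt)] at hi
      simp only [List.length_reverse, length_bulkNames] at hi
      have hjk : T.kind j.node ≠ .lam := by rw [hj]; exact kind_body_ne_lam _
      obtain ⟨e, β, hv, hβ, hb, he⟩ := ih _ (length_lt_of_drop ht) hj'.tail ho' hi rfl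
      refine ⟨d + 2 + e, β, (visible_lam_iff hk hd ht hjk).2 (.inr (.inr ⟨e, rfl, hv⟩)),
        by rw [getElem?_cons_drop ht, hβ], hb, ?_⟩
      rw [henv, har, if_neg hlt, if_neg (by omega), hd, Nat.add_sub_cancel, ht,
        (sem_body hjk).2.2.2.2.2.1, he]
      congr 2
      rw [show d + 2 + e = d + (1 + e) + 1 by omega, List.drop_succ_cons, ← List.drop_drop, ht,
        Nat.add_comm 1 e, List.drop_succ_cons]

theorem NormTrav.env_free {o : Occ} {t : JSeq} {a : List ℕ} (h : T.NormTrav (o :: t))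
    (ho : o.node = .lam a) (x : ℕ) :
    (T.sem (o :: t)).env ((T.scope a).length + x) = freeVal x := by
  induction hn : t.length using Nat.strong_induction_on generalizing o t a with
  | _ n ih =>
  subst hn
  have hk : T.kind o.node = .lam := by simp [ho]
  have henv := (sem_lam (t := t) hk).2.2.1
  rcases h.lam_cases ho with ⟨rfl, rfl, hd⟩ | ⟨a', c, d, j, o', t', rfl, hd, -, ht, hj, ho', hj', -⟩
  · have har : T.arity o.node = T.lamArity := by rw [ho]; exact arity_lam rfl
    rw [henv, har, if_neg (by simp [scope, scopeFrom, length_bulkNames]), if_pos hd]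
    simp [scope, scopeFrom, length_bulkNames]
  · obtain ⟨u, hu⟩ := sub_of_lam h ho
    have har : T.arity o.node = u.lamArity := by rw [ho]; exact arity_lam hu
    have hjk : T.kind j.node ≠ .lam := by rw [hj]; exact kind_body_ne_lam _
    rw [scope_concat hu, List.length_append, length_bulkNames, henv, har, if_neg (by omega),
      if_neg (by omega), hd, Nat.add_sub_cancel, ht, (sem_body hjk).2.2.2.2.2.1,
      show (T.scope a').length + u.lamArity + x - u.lamArity = (T.scope a').length + x by omega,
      ih _ (length_lt_of_drop ht) hj'.tail ho' rfl]

/-- At a lambda node of the tree the current term is a closure: the subtree in the environment `σ`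
of the lambda above, or of the free variables at the root. -/
theorem NormTrav.cur_lam {o : Occ} {t : JSeq} {a : List ℕ} {u : CTree} (h : T.NormTrav (o :: t))
    (ho : o.node = .lam a) (hu : T.sub a = some u) : ∃ σ : ℕ → Term,
    (T.sem (o :: t)).cur = u.toTerm.subst σ ∧
    (T.sem (o :: t)).env = fun i => if i < u.lamArity then
      (T.sem (o :: t)).val (u.lamArity - i) else σ (i - u.lamArity) := by
  have hk : T.kind o.node = .lam := by simp [ho]
  obtain ⟨-, -, henv, hcur⟩ := sem_lam (t := t) hk
  have har : T.arity o.node = u.lamArity := by rw [ho]; exact arity_lam hu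
  rcases h.lam_cases ho with ⟨rfl, rfl, hd⟩ |
    ⟨a', c, d, j, o', t', rfl, hd, hc, ht, hj, ho', hj', v, v', hv, hv'⟩
  · simp only [sub, Option.some.injEq] at hu
    subst hu
    refine ⟨freeVal, by rw [hcur, if_pos hd], ?_⟩
    funext i
    rw [henv, har, if_pos hd]
  · obtain rfl := Option.some.inj (((sub_concat hv).trans hv').symm.trans hu)
    have hjk : T.kind j.node ≠ .lam := by rw [hj]; exact kind_body_ne_lam _
    have hle := child_le_numOperands hv'
    refine ⟨(T.sem (o' :: t')).env, ?_, ?_⟩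
    · rw [hcur, if_neg (by omega), hd, Nat.add_sub_cancel, ht, hc]
      simp only [linkVal]
      rw [(sem_body hjk).2.2.2.2.2.2.1, hj, arity_body hv, if_pos hle]
      simp [childTerm, hv, hv']
    · funext i
      rw [henv, har, if_neg (show ¬ o.dist = 0 by omega), hd, Nat.add_sub_cancel, ht, (sem_body hjk).2.2.2.2.2.1]

/-- The head of the unique child of a lambda node. -/
theorem NormTrav.cur_var {o o' : Occ} {t : JSeq} {a : List ℕ} {u : CTree} {i : ℕ}
    (h : T.NormTrav (o' :: o :: t)) (ho : o.node = .lam a) (ho' : o'.node = .body a)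
    (hu : T.sub a = some u) (hi : u.head = some i) :
    (T.sem (o' :: o :: t)).cur = (T.sem (o :: t)).env i := by
  have hk : T.kind o'.node = .var := by rw [ho']; exact kind_body_of_head hu hi
  have hcur := (sem_body (T := T) (o := o') (t := o :: t) (by simp [hk])).2.2.2.2.2.2.2
  rw [hcur, hk, if_neg (by simp)]
  cases h with
  | app _ hk' => simp [ho] at hk'
  | lamApp _ _ hk' => simp [hk'] at hk
  | lamVar h0 ho₂ _ hd hv he =>
    simp only [TNode.body.injEq] at ho'
    subst ho'
    simp only [Nat.add_sub_cancel]
    generalize e : Occ.node _ = m at he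
    cases he with
    | bound h1 h2 h3 =>
      obtain rfl := Option.some.inj (hu.symm.trans h1)
      obtain rfl := Option.some.inj (hi.symm.trans h2)
      obtain ⟨d', β', hv', hd', hβ', he'⟩ := h0.env_bound ho h3
      obtain rfl := h0.visible_unique ho hv hd e hv' hd' hβ'
      exact he'.symm
    | free h1 h2 =>
      obtain rfl := Option.some.inj (hu.symm.trans h1)
      obtain rfl := Option.some.inj (hi.symm.trans h2)
      exact (h0.env_free ho _).symm
  | lamGhost => simp at ho'
  | var _ hk' => simp [ho] at hk'
  | ivar _ hk' => simp [ho] at hk'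

/-! ### Moves and evaluation -/

theorem childTerm_body {a : List ℕ} {u : CTree} (hu : T.sub a = some u) (k : ℕ) :
    T.childTerm (.body a) k = ((u.child k).map toTerm).getD (.var 0) := by
  simp [childTerm, hu]

theorem argList_congr {v w : ℕ → Term} {h : ℕ} (e : ∀ j, j < h → v (j + 1) = w (j + 1)) :
    Term.argList v h = Term.argList w h := by
  simp only [Term.argList, List.map_inj_left, List.mem_range]
  exact e

theorem argList_add (v : ℕ → Term) (m h : ℕ) :
    Term.argList v (m + h) = Term.argList v m ++ Term.argList (fun j => v (m + j)) h := by
  simp [Term.argList, List.range_add, Function.comp_def, add_assoc]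

/-- A move from a lambda node to its child performs head reduction steps. -/
theorem NormTrav.evals_body {o o' : Occ} {t : JSeq} {a : List ℕ} (hT : T.Proper)
    (h : T.NormTrav (o' :: o :: t)) (ho : o.node = .lam a) (ho' : o'.node = .body a)
    {x c : ℕ} {as : List Term} :
    (T.sem (o :: t)).Evals x as c ↔
      ∃ c', c = c' + T.arity o'.node + T.arity o.node ∧ (T.sem (o' :: o :: t)).Evals x as c' := by
  obtain ⟨u, hu⟩ := sub_of_lam h.tail ho
  obtain ⟨σ, hcur, henv⟩ := h.tail.cur_lam ho hu
  have hk : T.kind o.node = .lam := by simp [ho]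
  have hk' : T.kind o'.node ≠ .lam := by rw [ho']; exact kind_body_ne_lam _
  have har : T.arity o.node = u.lamArity := by rw [ho]; exact arity_lam hu
  have har' : T.arity o'.node = u.numOperands := by rw [ho']; exact arity_body hu
  obtain ⟨g1, g2, -, -⟩ := sem_lam (t := t) hk
  obtain ⟨h1, h2, h3, -, -, -, h7, h8⟩ := sem_body (t := o :: t) hk'
  -- `X` is what stands in head position below the bulk: the variable, or the operator of the
  -- `@`-node. The list `us` contains the operands.
  have hsplit : ∃ (X : Term) (us : List CTree), u.toTerm = Term.lams u.lamArity (X.apps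
      (us.map toTerm)) ∧ us.length = u.numOperands ∧
      (∀ j, j < u.numOperands → u.child (j + 1) = us[j]?) ∧
      (T.sem (o' :: o :: t)).cur = X.subst (T.sem (o :: t)).env := by
    have hp := hT.sub hu
    match u, hu, hp with
    | .node n (some i) cs, hu, hp =>
      exact ⟨.var i, cs, by rw [toTerm, toTerms_eq_map]; rfl, rfl, fun _ _ => rfl,
        h.cur_var ho ho' hu rfl⟩
    | .node n none [], hu, .node hp _ => simp at hp
    | .node n none (c :: cs), hu, hp =>
      refine ⟨c.toTerm, cs, by rw [toTerm, toTerms_eq_map]; rfl, rfl, fun _ _ => rfl, ?_⟩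
      have happ : T.kind o'.node = .app := by rw [ho']; simp [kind, hu, head]
      rw [h8, if_pos happ, h7, if_pos (by omega), ho', childTerm_body hu]
      rfl
  obtain ⟨X, us, e1, e2, e3, e4⟩ := hsplit
  -- The operands come first, then the arguments that the bulk has not consumed.
  have hargs : Term.argList (T.sem (o' :: o :: t)).val (T.sem (o' :: o :: t)).inHeight =
      (us.map toTerm).map (·.subst (T.sem (o :: t)).env) ++
      Term.argList (fun j => (T.sem (o :: t)).val (u.lamArity + j))
        ((T.sem (o :: t)).inHeight - u.lamArity) := by
    rw [h3, har', argList_add, g2, har]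
    congr 1
    · apply List.ext_getElem?
      intro j
      rw [Term.getElem?_argList]
      split_ifs with hj
      · rw [h7, har', if_pos (by omega), ho', childTerm_body hu, e3 j hj]
        have hj' : j < us.length := by omega
        simp [hj']
      · simp [show us.length ≤ j by omega]
    · apply argList_congr
      intro j hj
      rw [h7, har', if_neg (by omega), sem_arity, har]
      congr 1; omega
  unfold Sem.Evals
  rw [hcur, e1, Term.evals_lams (k := (T.sem (o :: t)).inBinders)
    (fun j => (sem_names h.tail j).2 hk), ← henv, hargs, h1, h2, g1, har, har', e4]
  simp only [Term.evals_apps, List.length_map, e2]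
  constructor
  · rintro ⟨_, rfl, c, rfl, hc⟩; exact ⟨c, rfl, hc⟩
  · rintro ⟨c, rfl, hc⟩; exact ⟨_, rfl, c, rfl, hc⟩

theorem kind_eq_lam {n : TNode} (h : T.kind n = .lam) :
    (∃ a, n = .lam a) ∨ ∃ m k, n = .ghostLam m k := by
  match n with
  | .lam a => exact .inl ⟨a, rfl⟩
  | .ghostLam m k => exact .inr ⟨m, k, rfl⟩
  | .body a => exact absurd h (kind_body_ne_lam a)
  | .ghostVar m k => simp at h

theorem Enables.arity_lt {m m' : TNode} {k k' : ℕ} (h : T.Enables m (.idx k) (.ghostLam m' k')) :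
    m' = m ∧ k' = k ∧ T.arity m < k := by
  cases h with
  | ghostLam _ h => exact ⟨rfl, rfl, h⟩

/-- A ghost lambda and the ghost variable after it do not change the remaining evaluation. -/
theorem NormTrav.evals_ghost {o o' : Occ} {t : JSeq} {m : TNode} {k : ℕ}
    (h : T.NormTrav (o' :: o :: t)) (ho : o.node = .ghostLam m k) {x c : ℕ} {as : List Term} :
    (T.sem (o :: t)).Evals x as c ↔ (T.sem (o' :: o :: t)).Evals x as c := by
  have hk : T.kind o.node = .lam := by simp [ho]
  have har : T.arity o.node = 0 := by simp [ho, arity]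
  have hd0 : o.dist ≠ 0 := by
    intro hd
    rcases h.tail.lastOcc.unjustified hd with h | h <;> simp [ho] at h
  obtain ⟨d, j, p, t', i, hd, hi, hdrop, he, hj, hp, -⟩ := h.tail.lam_parent hk hd0
  rw [ho] at he
  obtain ⟨-, -, hlt⟩ := he.arity_lt
  obtain ⟨g1, g2, -, g4⟩ := sem_lam (t := t) hk
  -- A ghost lambda stands for an argument beyond the operands of its justifier `j`, hence for one
  -- inherited from the preceding lambda `p`, at exactly the label that the ghost variable gets.
  have hval : (T.sem (o :: t)).cur = (T.sem (p :: t')).val (T.arity p.node + (i - T.arity j.node)) := by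
    rw [g4, if_neg hd0, hd, Nat.add_sub_cancel, hdrop, hi]
    simp only [linkVal]
    rw [(sem_body hj).2.2.2.2.2.2.1, if_neg (by omega), sem_arity]
  have hdrop' : t.drop (d + 1) = p :: t' := by rw [← List.drop_drop, hdrop]; rfl
  have main : T.kind o'.node = .var ∧ T.arity o'.node = 0 ∧
      linkVal (T.sem ((o :: t).drop (o'.dist - 1))).val o'.label = (T.sem (o :: t)).cur := by
    cases h with
    | app _ hk' => simp [ho] at hk'
    | lamApp _ ho' => simp [ho] at ho'
    | lamVar _ ho' => simp [ho] at ho'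
    | lamGhost _ _ hi' hm hα =>
      refine ⟨rfl, rfl, ?_⟩
      rw [hi] at hi'
      simp only [Link.idx.injEq] at hi'
      subst hi'
      rw [hd, List.getElem?_cons_succ, ← Nat.add_zero d, getElem?_of_drop hdrop] at hm
      rw [hd, List.getElem?_cons_succ, getElem?_of_drop hdrop] at hα
      simp only [List.getElem?_cons_zero, List.getElem?_cons_succ, Option.some.injEq] at hm hα
      subst hm hα
      rw [hval, hd, show d + 1 + 2 - 1 = d + 1 + 1 by omega, List.drop_succ_cons, hdrop']
      simp only [linkVal]
      congr 1; omega
    | var _ hk' => simp [ho] at hk'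
    | ivar _ hk' => simp [ho] at hk'
  obtain ⟨hk', har', hcur⟩ := main
  obtain ⟨h1, h2, h3, -, -, -, h7, h8⟩ := sem_body (t := o :: t) (show T.kind o'.node ≠ .lam by
    simp [hk'])
  unfold Sem.Evals
  rw [h1, h2, h3, h8, hcur, if_neg (by simp [hk']), g1, g2, har, har']
  simp only [Nat.zero_sub, Nat.add_zero, Nat.zero_add, Nat.sub_zero]
  rw [argList_congr (v := (T.sem (o' :: o :: t)).val) (w := (T.sem (o :: t)).val)]
  intro i _
  rw [h7, har', if_neg (by omega), sem_arity, har]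
  simp

/-- A move from an internal variable or `@`-node does not change the remaining evaluation. -/
theorem NormTrav.evals_call {o o' : Occ} {t : JSeq} (h : T.NormTrav (o' :: o :: t))
    (hk : T.kind o.node ≠ .lam) (hx : ¬ T.External o.node) {x c : ℕ} {as : List Term} :
    (T.sem (o :: t)).Evals x as c ↔ (T.sem (o' :: o :: t)).Evals x as c := by
  obtain ⟨h1, h2, h3, h4, h5, -, h7, h8⟩ := sem_body (t := t) hk
  have hk' : T.kind o'.node = .lam := by
    by_contra hc
    obtain ⟨_, _, e, hp, -⟩ := h.lastOcc.after_lam hc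
    simp only [List.cons.injEq] at e
    exact hk (e.1 ▸ hp)
  have hx' : ¬ T.External o'.node := by
    rcases h.lastOcc.after_body hk' with e | ⟨_, _, e, -, hp⟩
    · simp at e
    · simp only [List.cons.injEq] at e
      rwa [hp, ← e.1]
  obtain ⟨g1, g2, g3, g4⟩ := sem_lam_internal (t := o :: t) hk' hx'
  -- For a variable, its internal binder has inherited the values of the occurrence before it, so
  -- the same label read at that occurrence yields the same term.
  have hcur : (T.sem (o' :: o :: t)).cur = (T.sem (o :: t)).cur := by
    rw [(sem_lam hk').2.2.2]
    cases h with
    | app _ hka => rw [h8, if_pos hka]; rfl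
    | lamApp _ ho' => simp [ho'] at hk
    | lamVar _ ho' => simp [ho'] at hk
    | lamGhost _ ho' => simp [ho'] at hk
    | var h0 hkv _ hi _ hα hm =>
      obtain ⟨d, j, t', hd, hdrop, he, hj, hjt⟩ := h0.var_binder hkv
      rw [hd, List.getElem?_cons_succ, getElem?_of_drop hdrop] at hm
      rcases hjt.lastOcc.after_body hj with e | ⟨p, t₂, rfl, hp, -⟩
      · simp [e] at hm
      · have hdrop' : t.drop (d + 1) = p :: t₂ := by rw [← List.drop_drop, hdrop]; rfl
        rw [h8, if_neg (show ¬ T.kind o.node = .app by simp [hkv]), if_neg (Nat.succ_ne_zero _), hd,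
          Nat.add_sub_cancel, hdrop, hi,
          show d + 1 + 2 - 1 = d + 1 + 1 by omega, List.drop_succ_cons, hdrop']
        simp only [linkVal]
        rw [(sem_lam_internal hj (fun hc => hx (he.external_iff.2 hc))).2.2.2]
    | ivar _ _ hx' => exact absurd hx' hx
  unfold Sem.Evals
  rw [g1, g2, g3, g4, hcur, h2, h3, h4, h5]

/-! ### External occurrences -/

/-- The number `p` is the place of the binder among the external occurrences. For a free variable
the binder is the root, whose place 1 is the one used by `freeVal`. The second equation makes the
name encode the distance in the core. -/
theorem NormTrav.cur_external {o : Occ} {t : JSeq} (h : T.NormTrav (o :: t))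
    (hk : T.kind o.node = .var) (hx : T.External o.node) : ∃ p,
    (T.sem (o :: t)).cur = .var (Term.name p o.label) ∧
    T.extCount t + 1 - p = T.extCount (t.take o.dist) := by
  obtain ⟨d, j, t', hd, hdrop, he, hj, hjt⟩ := h.var_binder hk
  have hjx := he.external_iff.1 hx
  have h8 := (sem_body (o := o) (t := t) (show T.kind o.node ≠ .lam by simp [hk])).2.2.2.2.2.2.2
  refine ⟨T.extCount t' + 1, ?_, ?_⟩
  · rw [h8, if_neg (by simp [hk]), hd, Nat.add_sub_cancel, hdrop]
    rcases hl : o.label with k | x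
    · exact (sem_lam_external hj hjx).2.2.2 k
    · rw [hl] at he
      generalize e : j.node = m at he
      generalize o.node = n at he
      cases he
      rcases hjt.lam_cases e with ⟨-, rfl, -⟩ | ⟨a, c, _, _, _, _, e, -⟩
      · simp [linkVal, freeVal, extCount]
      · simp at e
  · have hdrop' : t.drop (d + 1) = t' := by rw [← List.drop_drop, hdrop]; rfl
    have : T.extCount t = T.extCount (t.take (d + 1)) + T.extCount t' := by
      rw [← hdrop', extCount, extCount, extCount, ← List.countP_append, List.take_append_drop]
    rw [hd]; omega

/-- The height at `n` is `|n|` plus the truncated difference of the previous height and `|α|`,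
restarting from 0 at an external lambda. Unfolding the truncations along the strand produces the
maximum. -/
theorem NormTrav.arth_eq {o : Occ} {t : JSeq} (h : T.NormTrav (o :: t))
    (hk : T.kind o.node ≠ .lam) : T.arth (o :: t) = (T.sem (o :: t)).height := by
  induction hn : t.length using Nat.strong_induction_on generalizing o t with
  | _ n ih =>
  subst hn
  obtain ⟨p, t', rfl, hp, -⟩ := h.lastOcc.after_lam hk
  have h5 := (sem_body (t := p :: t') hk).2.2.2.2.1
  have g2 := (sem_lam (t := t') hp).2.1
  by_cases hx : T.External p.node
  · rw [h5, g2, (sem_lam_external hp hx).2.2.1]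
    simp [arth, strand, hx, strandThreshold]
  · rcases h.tail.lastOcc.after_body hp with rfl | ⟨q, t₂, rfl, hq, -⟩
    · exact absurd h.tail.external_of_singleton.2 hx
    · have := ih _ (by simp) h.tail.tail hq rfl
      obtain ⟨r, t₃, rfl, -⟩ := h.tail.tail.lastOcc.after_lam hq
      rw [h5, g2, (sem_lam_internal hp hx).2.2.1]
      simp only [arth] at this ⊢
      rw [strand, if_neg hx]
      rw [strand] at this ⊢
      rw [strandThreshold, this]
      · push_cast
        omega
      · simp

/-- The structure of the core. -/
noncomputable def coreShape (T : CTree) (s : JSeq) : Term.Shape := T.shape (T.core s)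

/-- The stack of pending lambdas affects only names, which the structure forgets. -/
theorem shape_coreAux (y : List BName) (s : JSeq) : T.shape (T.coreAux y s) = T.coreShape s := by
  induction s generalizing y with
  | nil => rfl
  | cons o t ih =>
    unfold coreShape core
    rw [coreAux, coreAux]
    split_ifs with h1 h2
    · rfl
    · rfl
    · rw [ih, ih]
    · rw [ih, ih]

theorem coreShape_external {o : Occ} {t : JSeq} (h : T.External o.node) :
    T.coreShape (o :: t) = (T.kind o.node, T.extCount (t.take o.dist), o.label) ::
      T.coreShape t := by
  unfold coreShape core
  rw [coreAux, if_pos h]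
  rfl

theorem coreShape_internal {o : Occ} {t : JSeq} (h : ¬ T.External o.node) :
    T.coreShape (o :: t) = T.coreShape t := by
  unfold coreShape core
  rw [coreAux, if_neg h]
  split_ifs <;> rw [shape_coreAux] <;> rfl

theorem extCount_cons_external {o : Occ} {t : JSeq} (h : T.External o.node) :
    T.extCount (o :: t) = T.extCount t + 1 := by
  simp [extCount, h]

theorem extCount_cons_internal {o : Occ} {t : JSeq} (h : ¬ T.External o.node) :
    T.extCount (o :: t) = T.extCount t := by
  simp [extCount, h]

theorem length_coreShape (s : JSeq) : (T.coreShape s).length = T.extCount s := by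
  induction s with
  | nil => rfl
  | cons o t ih =>
    by_cases h : T.External o.node
    · rw [coreShape_external h, extCount_cons_external h, List.length_cons, ih]
    · rw [coreShape_internal h, extCount_cons_internal h, ih]

end CTree

namespace CTree

variable {T : CTree}

/-! ### From traversals to paths of the Böhm tree -/

theorem not_external_of_lam {o p : Occ} {t : JSeq} (h : T.NormTrav (o :: p :: t))
    (hp : T.kind p.node ≠ .lam) : T.kind o.node = .lam ∧
      (T.External o.node ↔ T.External p.node) := by
  have hk : T.kind o.node = .lam := by
    by_contra hc
    obtain ⟨_, _, e, hp', -⟩ := h.lastOcc.after_lam hc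
    simp only [List.cons.injEq] at e
    exact hp (e.1 ▸ hp')
  refine ⟨hk, ?_⟩
  rcases h.lastOcc.after_body hk with e | ⟨_, _, e, -, hx⟩
  · simp at e
  · simp only [List.cons.injEq] at e
    rw [hx, ← e.1]

theorem after_lam_kind {o p : Occ} {t : JSeq} (h : T.NormTrav (o :: p :: t))
    (hp : T.kind p.node = .lam) : T.kind o.node ≠ .lam := by
  intro hc
  rcases h.lastOcc.after_body hc with e | ⟨_, _, e, hq, -⟩
  · simp at e
  · simp only [List.cons.injEq] at e
    exact hq (e.1 ▸ hp)

theorem NormTrav.evals_lam {o p : Occ} {t : JSeq} (hT : T.Proper) (h : T.NormTrav (o :: p :: t))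
    (hp : T.kind p.node = .lam) {x c : ℕ} {as : List Term}
    (he : (T.sem (o :: p :: t)).Evals x as c) : ∃ c', (T.sem (p :: t)).Evals x as c' := by
  rcases kind_eq_lam hp with ⟨a, ha⟩ | ⟨m, k, ha⟩
  · obtain ⟨_, _, e, -, ho⟩ := h.lastOcc.after_lam (after_lam_kind h hp)
    have ho' : o.node = .body a := by
      cases h with
      | app _ hk => simp [hp] at hk
      | lamApp _ h' => rw [ha] at h'; simp_all
      | lamVar _ h' => rw [ha] at h'; simp_all
      | lamGhost _ h' => simp [ha] at h'
      | var _ hk => simp [hp] at hk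
      | ivar _ hk => simp [hp] at hk
    exact ⟨_, (h.evals_body hT ha ho').2 ⟨c, rfl, he⟩⟩
  · exact ⟨c, (h.evals_ghost ha).2 he⟩

theorem NormTrav.coreShape_var {o p : Occ} {t : JSeq} (h : T.NormTrav (o :: p :: t))
    (hk : T.kind o.node = .var) (hx : T.External o.node) :
    ∃ x, T.coreShape (o :: p :: t) = Term.varStep (T.coreShape (p :: t)) x ∧
      (T.sem (o :: p :: t)).cur = .var x := by
  obtain ⟨q, hq, hc⟩ := h.cur_external hk hx
  refine ⟨_, ?_, hq⟩
  rw [coreShape_external hx, Term.varStep, length_coreShape, Term.namePos_name,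
    Term.nameLink_name, hc, hk]

/-- The invariant carries evaluations backwards: a terminating evaluation of the current state
extends to one that starts from the term `u` found at the last external lambda. On arrival at an
external variable the evaluation is complete, so this yields the evaluation that the path needs. -/
theorem NormTrav.path {o : Occ} {t : JSeq} (hT : T.Proper) (h : T.NormTrav (o :: t)) :
    (T.kind o.node = .var ∧ T.External o.node → Term.VarPath T.toTerm (T.coreShape (o :: t))
      (Term.argList (T.sem (o :: t)).val (T.sem (o :: t)).height)) ∧
    (¬ (T.kind o.node = .var ∧ T.External o.node) →
      ∃ u, Term.LamPath T.toTerm (T.coreShape (o :: t)) u ∧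
        (T.sem (o :: t)).pos = T.extCount (o :: t) ∧
        ∀ x as c, (T.sem (o :: t)).Evals x as c →
          ∃ c', Term.Evals (T.extCount (o :: t)) 0 u [] x as c') := by
  induction t generalizing o with
  | nil =>
    cases h
    have hx : T.External (.lam []) := external_root
    have hs := sem_lam_external (T := T) (o := ⟨.lam [], [], 0, .idx 0⟩) (t := []) rfl hx
    refine ⟨by simp, fun _ => ⟨T.toTerm.subst freeVal, ?_, ?_, ?_⟩⟩
    · rw [coreShape_external hx]; exact .root
    · rw [hs.1, extCount_cons_external hx]
    · intro x as c he
      refine ⟨c, ?_⟩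
      unfold Sem.Evals at he
      rw [hs.1, hs.2.1, hs.2.2.1, (sem_lam rfl).2.2.2] at he
      rw [extCount_cons_external hx]
      exact he
  | cons p t ih =>
    by_cases hp : T.kind p.node = .lam
    · have hk := after_lam_kind h hp
      obtain ⟨u, hu, hpos, hev⟩ := (ih h.tail).2 (by simp [hp])
      have hs := sem_body (t := p :: t) hk
      constructor
      · rintro ⟨hk', hx⟩
        obtain ⟨x, hx, hc⟩ := h.coreShape_var hk' hx
        have he : (T.sem (o :: p :: t)).Evals x
            (Term.argList (T.sem (o :: p :: t)).val (T.sem (o :: p :: t)).height) 0 := by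
          unfold Sem.Evals
          rw [hc, hs.2.2.1, ← hs.2.2.2.2.1]
          exact .var
        obtain ⟨c', he'⟩ := h.evals_lam hT hp he
        obtain ⟨c₂, he₂⟩ := hev _ _ _ he'
        rw [hx]
        rw [← length_coreShape] at he₂
        exact .var hu he₂
      · intro hn
        have hx : ¬ T.External o.node := by
          intro hx
          have : T.kind o.node = .var := by
            rcases e : T.kind o.node with _ | _ | _
            · exact absurd e hk
            · rfl
            · exact absurd hx (not_external_app e)
          exact hn ⟨this, hx⟩
        refine ⟨u, by rwa [coreShape_internal hx], by rw [extCount_cons_internal hx, hs.1, hpos], ?_⟩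
        intro x as c he
        obtain ⟨c', he'⟩ := h.evals_lam hT hp he
        rw [extCount_cons_internal hx]
        exact hev _ _ _ he'
    · obtain ⟨hk, hxx⟩ := not_external_of_lam h hp
      refine ⟨by simp [hk], fun _ => ?_⟩
      by_cases hx : T.External p.node
      · have hpv : T.kind p.node = .var := by
          rcases e : T.kind p.node with _ | _ | _
          · exact absurd e hp
          · rfl
          · exact absurd hx (not_external_app e)
        have hxo := hxx.2 hx
        obtain ⟨h1, h2, h3, -⟩ := sem_lam_external (t := p :: t) hk hxo
        have hcur := (sem_lam (t := p :: t) hk).2.2.2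
        have hpath := (ih h.tail).1 ⟨hpv, hx⟩
        generalize hsh : T.coreShape (p :: t) = s at hpath
        generalize has : Term.argList _ _ = as at hpath
        -- The labels allowed by the arity threshold index the arguments of the head variable.
        have hev : ∀ i : ℕ, 1 ≤ i → (i : ℤ) ≤ T.arth (p :: t) →
            as[i - 1]? = some ((T.sem (p :: t)).val i) := by
          intro i hi1 hi2
          rw [h.tail.arth_eq hp] at hi2
          rw [← has, Term.getElem?_argList, if_pos (by omega), Nat.sub_add_cancel hi1]
        cases h with
        | app _ hk' => simp [hpv] at hk'
        | lamApp _ h' => simp [h'] at hp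
        | lamVar _ h' => simp [h'] at hp
        | lamGhost _ h' => simp [h'] at hp
        | var _ _ hx' => exact absurd hx hx'
        | @ivar _ _ i α _ _ _ _ hi1 hi2 =>
          refine ⟨(T.sem (p :: t)).val i, ?_, ?_, ?_⟩
          · rw [coreShape_external hxo, hsh, hk]
            have : T.extCount (List.take 1 (p :: t)) = 1 := by simp [extCount, hx]
            simp only [this]
            cases hpath with
            | var hl he =>
              have := Term.LamPath.arg hl he (hev i hi1 hi2)
              rwa [Nat.sub_add_cancel hi1] at this
          · rw [h1, extCount_cons_external hxo]
          · intro x bs c he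
            unfold Sem.Evals at he
            rw [h1, h2, h3, hcur] at he
            rw [extCount_cons_external hxo]
            exact ⟨c, he⟩
      · obtain ⟨u, hu, hpos, hev⟩ := (ih h.tail).2 (fun hc => hx hc.2)
        have hxo : ¬ T.External o.node := fun hc => hx (hxx.1 hc)
        refine ⟨u, by rwa [coreShape_internal hxo],
          by rw [extCount_cons_internal hxo, (sem_lam_internal hk hxo).1, hpos], ?_⟩
        intro x as c he
        rw [extCount_cons_internal hxo]
        exact hev _ _ _ ((h.evals_call hp hx).2 he)

theorem NormTrav.coreShape_mem_paths {s : JSeq} (hT : T.Proper) (h : T.NormTrav s) :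
    T.coreShape s ∈ Term.paths T.toTerm := by
  match s, h with
  | o :: t, h =>
    by_cases hc : T.kind o.node = .var ∧ T.External o.node
    · exact .inr ⟨_, (h.path hT).1 hc⟩
    · obtain ⟨u, hu, -⟩ := (h.path hT).2 hc
      exact .inl ⟨u, hu⟩

/-! ### From paths of the Böhm tree to traversals -/

/-- The binder is internal, so it is not the initial occurrence and has a predecessor, which enables
some lambda, possibly a ghost, with any positive label. -/
theorem NormTrav.exists_call {o : Occ} {t : JSeq} {k : ℕ} (h : T.NormTrav (o :: t))
    (hk : T.kind o.node = .var) (hx : ¬ T.External o.node) (hl : o.label = .idx k) (hk1 : 1 ≤ k) :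
    ∃ β, T.NormTrav (⟨β, [], o.dist + 2, .idx k⟩ :: o :: t) := by
  obtain ⟨d, j, t', hd, hdrop, he, hj, hjt⟩ := h.var_binder hk
  rcases hjt.lastOcc.after_body hj with rfl | ⟨p, t₂, rfl, hp, -⟩
  · exact absurd (he.external_iff.2 hjt.external_of_singleton.2) hx
  · obtain ⟨β, hβ⟩ := exists_enables hp hk1
    refine ⟨β, h.var hk hx hl hk1 (α := j) (m := p) ?_ ?_ hβ⟩
    · rw [hd, List.getElem?_cons_succ, ← Nat.add_zero d, getElem?_of_drop hdrop]; rfl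
    · rw [hd, List.getElem?_cons_succ, getElem?_of_drop hdrop]; rfl

theorem mem_scope {a b : List ℕ} {k : ℕ} {u : CTree} (hu : T.sub a = some u)
    (h : (b, k) ∈ T.scope a) : 1 ≤ k ∧ k ≤ T.arity (.lam b) := by
  induction a using List.reverseRecOn generalizing u with
  | nil =>
    simp only [scope, scopeFrom, bulkNames, List.mem_map, List.mem_range, Prod.mk.injEq] at h
    obtain ⟨j, hj, rfl, rfl⟩ := h
    rw [arity_lam rfl]; omega
  | append_singleton a c ih =>
    obtain ⟨v, hv⟩ : ∃ v, T.sub a = some v := by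
      rw [sub_append] at hu
      obtain ⟨v, hv, -⟩ := Option.bind_eq_some_iff.1 hu
      exact ⟨v, hv⟩
    rw [scope_concat hu, List.mem_append] at h
    rcases h with h | h
    · exact ih hv h
    · simp only [bulkNames, List.mem_map, List.mem_range, Prod.mk.injEq] at h
      obtain ⟨j, hj, rfl, rfl⟩ := h
      rw [arity_lam hu]; omega

/-- The move from a lambda node of the tree to a variable. -/
theorem NormTrav.exists_lamVar {o : Occ} {t : JSeq} {a : List ℕ} (h : T.NormTrav (o :: t))
    (ho : o.node = .lam a) (hk : T.kind (.body a) = .var) : ∃ d ℓ,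
      T.NormTrav (⟨.body a, [], d + 1, ℓ⟩ :: o :: t) ∧
      (T.External (.body a) ∨ ∃ k, ℓ = .idx k ∧ 1 ≤ k ∧ (T.arity o.node = 0 → o.dist + 1 ≤ d ∧
        o.dist ≠ 0)) := by
  obtain ⟨u, hu⟩ := sub_of_lam h ho
  have hk₀ : T.kind o.node = .lam := by simp [ho]
  rcases hi : u.head with _ | i
  · simp [kind, hu, hi] at hk
  by_cases hlt : i < (T.scope a).length
  · obtain ⟨⟨b, k⟩, hb⟩ : ∃ y, (T.scope a).reverse[i]? = some y :=
      ⟨_, List.getElem?_eq_getElem (by simpa using hlt)⟩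
    obtain ⟨d, β, hv, hβ, hβb, -⟩ := h.env_bound ho hb
    have hmem := mem_scope hu (List.mem_reverse.1 (List.mem_of_getElem? hb))
    refine ⟨d, .idx k, h.lamVar ho hk hβ hv (hβb ▸ .bound hu hi hb), .inr ⟨k, rfl, hmem.1, ?_⟩⟩
    -- With an empty bulk the binder is not `o` itself, and the justifier of `o` is no lambda, so
    -- the binder lies beyond it in the P-view. This makes the termination measure decrease.
    intro h0
    have hd0 : d ≠ 0 := by
      rintro rfl
      simp only [List.getElem?_cons_zero, Option.some.injEq] at hβ
      subst hβ
      rw [hβb] at h0; omega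
    by_cases hdist : o.dist = 0
    · rcases h.lastOcc.unjustified hdist with e | ⟨-, rfl⟩
      · simp [hk₀] at e
      · exact absurd ((visible_root hk₀ hdist).1 hv) hd0
    · obtain ⟨e, j, p, t', _, he, -, hdrop, -, hj, -⟩ := h.lam_parent hk₀ hdist
      rcases (visible_lam_iff hk₀ he hdrop hj).1 hv with rfl | rfl | ⟨k, rfl, -⟩
      · exact absurd rfl hd0
      · rw [List.getElem?_cons_succ, ← Nat.add_zero e, getElem?_of_drop hdrop] at hβ
        simp only [List.getElem?_cons_zero, Option.some.injEq] at hβ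
        subst hβ
        simp [hβb] at hj
      · omega
  · obtain ⟨d, β, hv, hβ, hβb⟩ := h.exists_visible ho List.nil_prefix
    have he : T.Enables β.node (.free (i - (T.scope a).length)) (.body a) :=
      hβb ▸ .free hu (by rw [hi]; congr 1; omega)
    exact ⟨d, _, h.lamVar ho hk hβ hv he, .inl (he.external_iff.2 (hβb ▸ external_root))⟩

theorem NormTrav.exists_lamGhost {o : Occ} {t : JSeq} {m : TNode} {k : ℕ}
    (h : T.NormTrav (o :: t)) (ho : o.node = .ghostLam m k) : ∃ n i, 1 ≤ i ∧ o.dist ≠ 0 ∧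
      T.kind n = .var ∧ T.NormTrav (⟨n, [], o.dist + 2, .idx i⟩ :: o :: t) := by
  have hd0 : o.dist ≠ 0 := by
    intro hd
    rcases h.lastOcc.unjustified hd with h | h <;> simp [ho] at h
  obtain ⟨d, j, p, t', i, hd, hi, hdrop, he, -⟩ := h.lam_parent (by simp [ho]) hd0
  rw [ho] at he
  obtain ⟨-, -, hlt⟩ := he.arity_lt
  refine ⟨_, _, ?_, hd0, ?_, h.lamGhost ho hi (m := j) (α := p) ?_ ?_⟩
  · omega
  · rfl
  · rw [hd, List.getElem?_cons_succ, ← Nat.add_zero d, getElem?_of_drop hdrop]; rfl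
  · rw [hd, List.getElem?_cons_succ, getElem?_of_drop hdrop]; rfl

theorem dist_le_length {o : Occ} {t : JSeq} (h : T.NormTrav (o :: t)) : o.dist ≤ t.length := by
  by_cases hd : o.dist = 0
  · omega
  · obtain ⟨d, j, t', hd, hdrop, -⟩ := h.lastOcc.justified hd
    have := congrArg List.length hdrop
    simp at this; omega

/-- If head evaluation terminates, the traversal goes on to an external variable. -/
theorem NormTrav.exists_external_var (hT : T.Proper) {x : ℕ} {as : List Term} (c n : ℕ)
    {o : Occ} {t : JSeq} (h : T.NormTrav (o :: t)) (hk : T.kind o.node = .lam)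
    (he : (T.sem (o :: t)).Evals x as c) (hn : t.length + 1 - o.dist = n) :
    ∃ o' t', T.NormTrav (o' :: t') ∧ T.kind o'.node = .var ∧ T.External o'.node ∧
      T.coreShape (o' :: t') = Term.varStep (T.coreShape (o :: t)) x ∧
      Term.argList (T.sem (o' :: t')).val (T.sem (o' :: t')).height = as := by
  -- Lexicographic induction on the number `c` of remaining head steps and on `n`, the place of the
  -- justifier of the last occurrence counted from the start. Moves without a head step send
  -- pointers strictly further back.
  induction c using Nat.strong_induction_on generalizing n o t with
  | _ c ihc =>
  induction n using Nat.strong_induction_on generalizing o t with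
  | _ n ihn =>
  have hle := dist_le_length h
  have finish : ∀ {o' : Occ} {c' : ℕ}, T.NormTrav (o' :: o :: t) → T.kind o'.node = .var →
      T.External o'.node → (T.sem (o' :: o :: t)).Evals x as c' →
      ∃ o' t', T.NormTrav (o' :: t') ∧ T.kind o'.node = .var ∧ T.External o'.node ∧
        T.coreShape (o' :: t') = Term.varStep (T.coreShape (o :: t)) x ∧
        Term.argList (T.sem (o' :: t')).val (T.sem (o' :: t')).height = as := by
    intro o' c' h' hk' hx' he'
    obtain ⟨y, hy, hc⟩ := h'.coreShape_var hk' hx'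
    have hs := sem_body (o := o') (t := o :: t) (show T.kind o'.node ≠ .lam by simp [hk'])
    unfold Sem.Evals at he'
    rw [hc, hs.2.2.1, ← hs.2.2.2.2.1] at he'
    cases he'
    exact ⟨o', _, h', hk', hx', hy, rfl⟩
  have skip : ∀ {o' o'' : Occ}, T.NormTrav (o'' :: o' :: o :: t) → T.kind o'.node ≠ .lam →
      ¬ T.External o'.node → T.kind o''.node = .lam ∧
      T.coreShape (o'' :: o' :: o :: t) = T.coreShape (o :: t) := by
    intro o' o'' h' hk' hx'
    obtain ⟨h1, h2⟩ := not_external_of_lam h' hk'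
    exact ⟨h1, by rw [coreShape_internal (fun hc => hx' (h2.1 hc)), coreShape_internal hx']⟩
  rcases kind_eq_lam hk with ⟨a, ha⟩ | ⟨m, k, ha⟩
  · obtain ⟨u, hu⟩ := sub_of_lam h ha
    by_cases hka : T.kind (.body a) = .app
    · have h1 := h.lamApp ha hka
      obtain ⟨c', rfl, he'⟩ := (h1.evals_body hT ha rfl).1 he
      have hxa := not_external_app hka
      have hp := hT.sub hu
      obtain ⟨v, hv, hpos⟩ : ∃ v, u.child 0 = some v ∧ 1 ≤ T.arity (.body a) := by
        rw [arity_body hu]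
        match u, hu, hp with
        | .node n (some i) cs, hu, _ => simp [kind, hu, head] at hka
        | .node n none [], _, .node hp _ => simp at hp
        | .node n none (c :: cs), _, .node hp _ =>
          have := hp rfl
          exact ⟨c, rfl, by simp [numOperands] at this ⊢; omega⟩
      have h2 := h1.app hka (.child hu hv)
      have hka' : T.kind (.body a) ≠ .lam := by simp [hka]
      obtain ⟨hk2, hs2⟩ := skip h2 hka' hxa
      rw [← hs2]
      exact ihc c' (by simp only; omega) _ h2 hk2 ((h2.evals_call hka' hxa).1 he') rfl
    · have hkv : T.kind (.body a) = .var := by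
        rcases e : T.kind (.body a) with _ | _ | _
        · exact absurd e (kind_body_ne_lam a)
        · rfl
        · exact absurd e hka
      obtain ⟨d, ℓ, h1, hd⟩ := h.exists_lamVar ha hkv
      obtain ⟨c', rfl, he'⟩ := (h1.evals_body hT ha rfl).1 he
      by_cases hx : T.External (.body a)
      · exact finish h1 hkv hx he'
      · obtain ⟨k, rfl, hk1, hd⟩ := hd.resolve_left hx
        obtain ⟨β, h2⟩ := h1.exists_call hkv hx rfl hk1
        have hkv' : T.kind (.body a) ≠ .lam := by simp [hkv]
        obtain ⟨hk2, hs2⟩ := skip h2 hkv' hx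
        have he2 := (h2.evals_call hkv' hx).1 he'
        rw [← hs2]
        -- No head step is made only if both arities vanish. Then the variable points beyond the
        -- justifier of `o`, and the next lambda to the occurrence just before its binder, so `n`
        -- decreases.
        by_cases h0 : T.arity o.node = 0 ∧ T.arity (.body a) = 0
        · obtain ⟨hd1, hd2⟩ := hd h0.1
          have hle1 := dist_le_length h1
          simp only [List.length_cons] at hle1
          refine ihn _ ?_ h2 hk2 (by simpa [h0] using he2) rfl
          simp only [List.length_cons]
          omega
        · exact ihc c' (by simp only; omega) _ h2 hk2 he2 rfl
  · obtain ⟨v, i, hi, hd0, hkv, h1⟩ := h.exists_lamGhost ha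
    have he' := (h1.evals_ghost ha).1 he
    by_cases hx : T.External v
    · exact finish h1 hkv hx he'
    · obtain ⟨β, h2⟩ := h1.exists_call hkv hx rfl hi
      have hkv' : T.kind v ≠ .lam := by simp [hkv]
      obtain ⟨hk2, hs2⟩ := skip h2 hkv' hx
      have hle1 := dist_le_length h1
      simp only [List.length_cons] at hle1
      rw [← hs2]
      refine ihn _ ?_ h2 hk2 ((h2.evals_call hkv' hx).1 he') rfl
      simp only [List.length_cons]
      omega

/-- The current term is tracked as well, since the next evaluation starts from it. The threshold
admits the label of every argument, and the lambda so reached stands for that argument. -/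
theorem exists_normTrav_of_lamPath (hT : T.Proper) {s : Term.Shape} {u : Term}
    (h : Term.LamPath T.toTerm s u) : ∃ o t, T.NormTrav (o :: t) ∧ T.kind o.node = .lam ∧
      T.External o.node ∧ T.coreShape (o :: t) = s ∧ (T.sem (o :: t)).cur = u := by
  induction h with
  | root =>
    refine ⟨_, _, .root, rfl, external_root, ?_, ?_⟩
    · rw [coreShape_external external_root]; rfl
    · rw [(sem_lam rfl).2.2.2, if_pos rfl]; rfl
  | @arg s u v x c i as _ hev hi ih =>
    obtain ⟨o, t, h, hk, hx, rfl, rfl⟩ := ih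
    obtain ⟨h1, h2, h3, -⟩ := sem_lam_external (t := t) hk hx
    rw [length_coreShape, extCount_cons_external hx] at hev
    obtain ⟨o', t', h', hk', hx', hs', rfl⟩ := h.exists_external_var hT (x := x) (as := as) c _ hk
      (by unfold Sem.Evals; rw [h1, h2, h3]; exact hev) rfl
    have hk'' : T.kind o'.node ≠ .lam := by simp [hk']
    rw [Term.getElem?_argList] at hi
    split_ifs at hi with hlt
    obtain ⟨β, hβ⟩ := exists_enables hk'' (k := i + 1) (by omega)
    have h4 := h'.ivar hk' hx' hβ (by omega) (by rw [h'.arth_eq hk'']; exact_mod_cast hlt)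
    obtain ⟨hkβ, hxβ⟩ := not_external_of_lam h4 hk''
    refine ⟨_, _, h4, hkβ, hxβ.2 hx', ?_, ?_⟩
    · rw [coreShape_external (hxβ.2 hx'), hs', hkβ]
      simp [extCount, hx']
    · rw [(sem_lam hkβ).2.2.2]
      simpa [linkVal] using hi

theorem exists_normTrav_of_mem_paths (hT : T.Proper) {s : Term.Shape}
    (h : s ∈ Term.paths T.toTerm) : ∃ o t, T.NormTrav (o :: t) ∧ T.External o.node ∧
      T.coreShape (o :: t) = s := by
  rcases h with ⟨u, hu⟩ | ⟨as, ⟨hl, hev⟩⟩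
  · obtain ⟨o, t, h, -, hx, hs, -⟩ := exists_normTrav_of_lamPath hT hu
    exact ⟨o, t, h, hx, hs⟩
  · obtain ⟨o, t, h, hk, hx, rfl, rfl⟩ := exists_normTrav_of_lamPath hT hl
    obtain ⟨h1, h2, h3, -⟩ := sem_lam_external (t := t) hk hx
    rw [length_coreShape, extCount_cons_external hx] at hev
    obtain ⟨o', t', h', -, hx', hs', -⟩ := h.exists_external_var hT _ _ hk
      (by unfold Sem.Evals; rw [h1, h2, h3]; exact hev) rfl
    exact ⟨o', t', h', hx', hs'⟩

theorem shape_image_cores (hT : T.Proper) : T.shape '' T.cores = Term.paths T.toTerm := by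
  ext s
  constructor
  · rintro ⟨_, ⟨t, ht, rfl⟩, rfl⟩
    exact ht.coreShape_mem_paths hT
  · intro hs
    obtain ⟨o, t, h, -, rfl⟩ := exists_normTrav_of_mem_paths hT hs
    exact ⟨_, ⟨_, h, rfl⟩, rfl⟩

theorem shape_image_extCores (hT : T.Proper) : T.shape '' T.extCores = Term.paths T.toTerm := by
  ext s
  constructor
  · rintro ⟨_, ⟨o, t, ht, -, rfl⟩, rfl⟩
    exact ht.coreShape_mem_paths hT
  · intro hs
    obtain ⟨o, t, h, hx, rfl⟩ := exists_normTrav_of_mem_paths hT hs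
    exact ⟨_, ⟨o, t, h, hx, rfl⟩, rfl⟩

/-! ### The structure determines the core -/

theorem coreShape_suffix (o : Occ) (t : JSeq) : T.coreShape t <:+ T.coreShape (o :: t) := by
  by_cases h : T.External o.node
  · rw [coreShape_external h]; exact List.suffix_cons _ _
  · rw [coreShape_internal h]

theorem coreShape_suffix_of_suffix {s t : JSeq} (h : s <:+ t) :
    T.coreShape s <:+ T.coreShape t := by
  obtain ⟨l, rfl⟩ := h
  induction l with
  | nil => exact List.suffix_rfl
  | cons o l ih => exact ih.trans (coreShape_suffix _ _)

/-- As long as one core structure extends the other, the traversals cannot branch: a branching could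
only come from different labels in (IVar), and these would show in the cores. -/
theorem NormTrav.suffix_or_suffix {s₁ s₂ : JSeq} (h₁ : T.NormTrav s₁) (h₂ : T.NormTrav s₂)
    (hs : T.coreShape s₁ <:+ T.coreShape s₂) : s₁ <:+ s₂ ∨ s₂ <:+ s₁ := by
  induction s₁ with
  | nil => exact .inl List.nil_suffix
  | cons o s₁ ih =>
    match s₁ with
    | [] =>
      left
      cases h₁
      clear ih hs
      induction h₂ with
      | root => exact List.suffix_rfl
      | _ => exact List.suffix_cons_iff.2 (.inr (by assumption))
    | p :: s =>
      rcases ih h₁.tail ((coreShape_suffix _ _).trans hs) with h | h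
      · obtain ⟨l, rfl⟩ := h
        rcases List.eq_nil_or_concat l with rfl | ⟨l, o', rfl⟩
        · exact .inr (List.suffix_cons _ _)
        · left
          simp only [List.concat_eq_append, List.append_assoc, List.singleton_append] at h₂ hs ⊢
          have h₃ : T.NormTrav (o' :: p :: s) := h₂.drop (d := l.length) (by simp)
          have : o = o' := by
            refine h₁.step_unique h₃ ?_
            -- Both successors of an external variable are external. The two core structures are
            -- suffixes of the same sequence and have the same length, so their first entries, and
            -- in particular the labels, agree.
            intro hk hx
            have hk' : T.kind p.node ≠ .lam := by simp [hk]
            have hx₁ := (not_external_of_lam h₁ hk').2.2 hx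
            have hx₃ := (not_external_of_lam h₃ hk').2.2 hx
            have hs₃ : T.coreShape (o' :: p :: s) <:+ T.coreShape (l ++ o' :: p :: s) :=
              coreShape_suffix_of_suffix (List.suffix_append _ _)
            have := List.suffix_of_suffix_length_le hs hs₃ (by
              simp [coreShape_external hx₁, coreShape_external hx₃])
            have := this.eq_of_length (by
              simp [coreShape_external hx₁, coreShape_external hx₃])
            rw [coreShape_external hx₁, coreShape_external hx₃] at this
            simp only [List.cons.injEq, Prod.mk.injEq] at this
            exact this.1.2.2
          rw [this]
          exact List.suffix_append _ _
      · exact .inr (h.trans (List.suffix_cons _ _))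

/-- Comparable traversals with the same core structure coincide if the longer one ends with an
external occurrence, since that occurrence adds an entry to the core. -/
theorem injOn_shape_extCores : Set.InjOn T.shape T.extCores := by
  have key : ∀ {o : Occ} {t s : JSeq}, T.External o.node → s <:+ o :: t →
      T.coreShape s = T.coreShape (o :: t) → s = o :: t := by
    intro o t s hx h he
    rcases List.suffix_cons_iff.1 h with h | h
    · exact h
    · have := (coreShape_suffix_of_suffix (T := T) h).length_le
      rw [he, coreShape_external hx] at this
      simp at this
  rintro _ ⟨o₁, t₁, h₁, hx₁, rfl⟩ _ ⟨o₂, t₂, h₂, hx₂, rfl⟩ (he : T.coreShape _ = T.coreShape _)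
  rcases h₁.suffix_or_suffix h₂ (he ▸ List.suffix_rfl) with h | h
  · rw [key hx₂ h he]
  · rw [key hx₁ h he.symm]

theorem isomorphic_of_shape_image {T₁ T₂ : CTree} {J₁ J₂ : Set JSeq}
    (h₁ : Set.InjOn T₁.shape J₁) (h₂ : Set.InjOn T₂.shape J₂)
    (h : T₁.shape '' J₁ = T₂.shape '' J₂) : Isomorphic T₁ T₂ J₁ J₂ := by
  have hex : ∀ j : J₁, ∃ j' : J₂, T₂.shape j'.1 = T₁.shape j.1 := by
    intro j
    obtain ⟨j', hj', e⟩ : T₁.shape j.1 ∈ T₂.shape '' J₂ := h ▸ ⟨j.1, j.2, rfl⟩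
    exact ⟨⟨j', hj'⟩, e⟩
  choose φ hφ using hex
  refine ⟨φ, ⟨?_, ?_⟩, hφ⟩
  · intro a b hab
    exact Subtype.ext (h₁ a.2 b.2 (by rw [← hφ, ← hφ, hab]))
  · intro b
    obtain ⟨j, hj, e⟩ : T₂.shape b.1 ∈ T₁.shape '' J₁ := h ▸ ⟨b.1, b.2, rfl⟩
    exact ⟨⟨j, hj⟩, Subtype.ext (h₂ (φ _).2 b.2 (by rw [hφ]; exact e))⟩

end CTree

theorem mainTheorem3 (M N : Term) (h : M.LinStep N) :
    M.ctree.shape '' M.ctree.cores = N.ctree.shape '' N.ctree.cores ∧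
      CTree.Isomorphic M.ctree N.ctree M.ctree.extCores N.ctree.extCores := by
  have hp : Term.paths M.ctree.toTerm = Term.paths N.ctree.toTerm := by
    rw [M.toTerm_ctree, N.toTerm_ctree, h.paths_eq]
  refine ⟨?_, CTree.isomorphic_of_shape_image CTree.injOn_shape_extCores
    CTree.injOn_shape_extCores ?_⟩
  · rw [CTree.shape_image_cores M.proper_ctree, CTree.shape_image_cores N.proper_ctree, hp]
  · rw [CTree.shape_image_extCores M.proper_ctree, CTree.shape_image_extCores N.proper_ctree, hp]
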